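/- There is a universal constant $C>0$ such that the following holds. Consider a tabular Bayesian reinforcement learning problem: finite state and action spaces $\mathcal S,\mathcal A$ with $S=|\mathcal S|$ and $A=|\mathcal A|$, an episode length $H\ge 1$, and a fixed initial state $s_1$. An environment $\mathcal E=\{(P_h,r_h)\}_{h=1}^H$ consists of transition kernels $P_h(\cdot\mid s,a)$ on $\mathcal S$ and reward distributions $r_h(\cdot\mid s,a)$ on $[0,1]$ that are absolutely continuous with respect to Lebesgue measure. The set of environments is a product $\Theta=\prod_h\Theta^P_h\times\prod_h\Theta^R_h$, and $\mathcal E$ is drawn from a product prior $\rho=\bigotimes_h\rho^P_h\otimes\bigotimes_h\rho^R_h$ carried by $\Theta$; the factors $\rho_h^P,\rho_h^R$ are otherwise arbitrary (in particular, they need not be Dirichlet). Let $\Pi$ be a class of stationary (layer-dependent, possibly randomized) policies, and write $V^{\mathcal E}_{h,\pi}(s)$ for the expected total reward of layers $h,\dots,H$ under $\pi$ in $\mathcal E$ when the state at layer $h$ is $s$. Assume that there is a measurable map $\mathcal E\mapsto\pi^*_{\mathcal E}\in\Pi$ with $V^{\mathcal E}_{h,\pi^*_{\mathcal E}}(s)=\max_{\pi\in\Pi}V^{\mathcal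 E}_{h,\pi}(s)$ for all $\mathcal E\in\Theta$, $h$ and $s$. In episode $\ell=1,2,\dots$, Thompson sampling (TS) draws $\mathcal E_\ell$ from the posterior of $\mathcal E$ given the history $\mathcal D_\ell$ of states, actions and rewards $(s_h,a_h,r_h)_{h\le H}$ of the first $\ell-1$ episodes, and then plays $\pi^*_{\mathcal E_\ell}$ in $\mathcal E$ from $s_1$. Its Bayesian regret over $L$ episodes is $$\mathfrak{BR}_L(\pi_{\rm TS})=\sum_{\ell=1}^L\mathbb E\big[V^{\mathcal E}_{1,\pi^*_{\mathcal E}}(s_1)-V^{\mathcal E}_{1,\pi^*_{\mathcal E_\ell}}(s_1)\big].$$ The value diameter is $\lambda=\big(\mathbb E_{\mathcal E\sim\rho}[\lambda_{\mathcal E}^2]\big)^{1/2}$, where $$\lambda_{\mathcal E}=\max_h\big(\max_sV^{\mathcal E}_{h,\pi^*_{\mathcal E}}(s)-\min_sV^{\mathcal E}_{h,\pi^*_{\mathcal E}}(s)\big)+\max_{h,s,a}\big(r_h^{\sup}(s,a)-r_h^{\inf}(s,a)\big),$$ and $r_h^{\sup}(s,a),r_h^{\inf}(s,a)$ are the essential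 supremum and infimum of the reward distribution $r_h(\cdot\mid s,a)$. Assume: (1) (Consistency) There are measurable estimators $\hat{\mathcal E}_\ell=\hat{\mathcal E}_\ell(\mathcal D_\ell)$ such that, for almost every environment $\mathcal E$ and almost every infinite TS history in $\mathcal E$, $\hat{\mathcal E}_\ell$ converges to $\mathcal E$ in all components that histories can reveal, namely $r_h(\cdot\mid s,a)$ for $h\le H$ (weakly) and $P_h(\cdot\mid s,a)$ for $h<H$, where only $s=s_1$ is considered if $h=1$. (2) (Visits) For almost every $\mathcal E$, the policy $\pi^*_{\mathcal E}$ run in $\mathcal E$ from $s_1$ visits every pair $(s,a)$ at every layer $h$ with positive probability, where only $s=s_1$ is considered if $h=1$. Then there is $L_0$, which may depend on the problem, such that for all $L\ge L_0$, with $T=LH$, $$\mathfrak{BR}_L(\pi_{\rm TS})\le C\,\lambda\,\sqrt{HSAT}\,\sqrt{\log(HSAL)}.$$ -/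

import Mathlib

open MeasureTheory ProbabilityTheory Filter Topology

noncomputable section

namespace BayesRL

universe u v w

/-- The transition function of one layer: a probability vector on `S` for every state-action
pair. -/
abbrev Transition (S : Type u) (A : Type v) [Fintype S] : Type (max u v) :=
  S → A → stdSimplex ℝ S

/-- A reward distribution: a probability measure carried by `[0,1]` and absolutely continuous
with respect to Lebesgue measure on `[0,1]`. -/
abbrev RewardLaw : Type :=
  {m : ProbabilityMeasure ℝ // (m : Measure ℝ) ≪ (volume : Measure ℝ).restrict (Set.Icc 0 1)}

/-- The reward function of one layer: a reward distribution for every state-action pair. -/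
abbrev Reward (S : Type u) (A : Type v) : Type (max u v) :=
  S → A → RewardLaw

/-- An environment with episode length `H`: transition and reward functions of all the layers.
The layers are numbered `0, …, H - 1`. -/
abbrev Env (S : Type u) (A : Type v) [Fintype S] (H : ℕ) : Type (max u v) :=
  (Fin H → Transition S A) × (Fin H → Reward S A)

/-- A stationary policy: a distribution of actions for every layer and every current state. -/
abbrev Policy (S : Type u) (A : Type v) [Fintype A] (H : ℕ) : Type (max u v) :=
  Fin H → S → stdSimplex ℝ A

/-- The history `(s_h, a_h, r_h)_h` of one episode. -/
abbrev Traj (S : Type u) (A : Type v) (H : ℕ) : Type (max u v) :=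
  Fin H → S × A × ℝ

/-- The mean of a reward distribution. -/
def meanReward (m : RewardLaw) : ℝ := ∫ x, x ∂(m.1 : Measure ℝ)

/-- The largest attainable reward (essential supremum). -/
def rewardSup (m : RewardLaw) : ℝ := essSup (fun x : ℝ => x) (m.1 : Measure ℝ)

/-- The smallest attainable reward (essential infimum). -/
def rewardInf (m : RewardLaw) : ℝ := essInf (fun x : ℝ => x) (m.1 : Measure ℝ)

/-- Forget the first `h` layers of a family indexed by layers. -/
def dropLayers {α : Type*} {H : ℕ} (h : ℕ) (x : Fin H → α) : Fin (H - h) → α :=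
  fun i => x ⟨h + i, by have := i.2; omega⟩

section Trajectories

variable {S : Type u} {A : Type v} [Fintype S] [Fintype A]

open Classical in
/-- Probability that the state-action sequence of an episode of `n` layers, started in state `s`,
is `τ`: the first state is `s`, the action is drawn from the policy, the next state from the
transition function, and the episode goes on from there. -/
def pathProb : (n : ℕ) → (Fin n → Transition S A) → Policy S A n → S → (Fin n → S × A) → ℝ
  | 0, _, _, _, _ => 1
  | n + 1, P, π, s, τ =>
      (if (τ 0).1 = s then 1 else 0) * (π 0 s).1 (τ 0).2 *
        ∑ s' : S, (P 0 s (τ 0).2).1 s' *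
          pathProb n (Fin.tail P) (Fin.tail π) s' (Fin.tail τ)

/-- The value function at layer `h` (layers numbered from `0`): expected sum of the mean rewards
of the layers `h, …, H - 1` when the state at layer `h` is `s`. It is zero for `h ≥ H`. -/
def value {H : ℕ} (E : Env S A H) (π : Policy S A H) (h : ℕ) (s : S) : ℝ :=
  ∑ τ : Fin (H - h) → S × A,
    pathProb (H - h) (dropLayers h E.1) (dropLayers h π) s τ *
      ∑ i, meanReward (dropLayers h E.2 i (τ i).1 (τ i).2)

open Classical in
/-- The probability that the state-action pair at layer `h` is `(s, a)`, when policy `π` is run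
in `E` from the initial state `s₁`. The occupancy density with respect to the uniform
distribution on `S × A` is this number times `|S| |A|`. -/
def occupancy {H : ℕ} (E : Env S A H) (π : Policy S A H) (s₁ : S) (h : Fin H) (s : S) (a : A) :
    ℝ :=
  ∑ τ : Fin H → S × A, if τ h = (s, a) then pathProb H E.1 π s₁ τ else 0

/-- The law of the history of one episode when policy `π` is run in `E` from `s₁`: given the
states and the actions, the rewards of the layers are independent, the reward of layer `h` having
law `r_h(s_h, a_h)`. -/
def trajLaw [MeasurableSpace S] [MeasurableSpace A] {H : ℕ}
    (E : Env S A H) (π : Policy S A H) (s₁ : S) : Measure (Traj S A H) :=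
  ∑ τ : Fin H → S × A,
    ENNReal.ofReal (pathProb H E.1 π s₁ τ) •
      (Measure.pi (fun h : Fin H => ((E.2 h (τ h).1 (τ h).2).1 : Measure ℝ))).map
        (fun x h => ((τ h).1, (τ h).2, x h))

end Trajectories

/-- A tabular, time inhomogeneous Bayesian reinforcement learning problem with state space `S`,
action space `A` and episode length `H`. -/
structure TabularProblem (S : Type u) (A : Type v) [Fintype S] [Fintype A] (H : ℕ) where
  /-- the fixed initial state -/
  init : S
  /-- the transition functions allowed at layer `h` -/
  thetaP : Fin H → Set (Transition S A)
  /-- the reward functions allowed at layer `h` -/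
  thetaR : Fin H → Set (Reward S A)
  /-- the prior of the transition function of layer `h` -/
  priorP : Fin H → Measure (Transition S A)
  /-- the prior of the reward function of layer `h` -/
  priorR : Fin H → Measure (Reward S A)
  isProb_priorP : ∀ h, IsProbabilityMeasure (priorP h)
  isProb_priorR : ∀ h, IsProbabilityMeasure (priorR h)
  priorP_theta : ∀ h, ∀ᵐ p ∂(priorP h), p ∈ thetaP h
  priorR_theta : ∀ h, ∀ᵐ r ∂(priorR h), r ∈ thetaR h
  /-- the policy class, a set of stationary policies -/
  policies : Set (Policy S A H)
  /-- a measurable choice of an optimal policy within the policy class -/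
  optPolicy : Env S A H → Policy S A H
  measurable_optPolicy : Measurable optPolicy
  optPolicy_mem : ∀ E : Env S A H, (∀ h, E.1 h ∈ thetaP h ∧ E.2 h ∈ thetaR h) →
    optPolicy E ∈ policies
  optPolicy_max : ∀ E : Env S A H, (∀ h, E.1 h ∈ thetaP h ∧ E.2 h ∈ thetaR h) →
    ∀ π ∈ policies, ∀ h : Fin H, ∀ s : S, value E π h s ≤ value E (optPolicy E) h s

namespace TabularProblem

variable {S : Type u} {A : Type v} [Fintype S] [Fintype A] {H : ℕ}

/-- The prior on environments: layers, transitions and rewards are all independent. -/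
def prior (M : TabularProblem S A H) : Measure (Env S A H) :=
  (Measure.pi M.priorP).prod (Measure.pi M.priorR)

/-- The optimal value function of `E` (within the policy class). -/
def optValue (M : TabularProblem S A H) (E : Env S A H) (h : ℕ) (s : S) : ℝ :=
  value E (M.optPolicy E) h s

/-- The value diameter of an environment. -/
def envDiameter (M : TabularProblem S A H) (E : Env S A H) : ℝ :=
  (⨆ h : Fin H, ((⨆ s : S, M.optValue E h s) - ⨅ s : S, M.optValue E h s)) +
    ⨆ p : Fin H × S × A, (rewardSup (E.2 p.1 p.2.1 p.2.2) - rewardInf (E.2 p.1 p.2.1 p.2.2))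

/-- The average value diameter `λ`. -/
def valueDiameter (M : TabularProblem S A H) : ℝ :=
  Real.sqrt (∫ E, M.envDiameter E ^ 2 ∂M.prior)

/-- The optimal policy of almost every environment visits, in that environment, every
state-action pair at every layer. At the first layer only the initial state can be visited. -/
def VisitsEverything (M : TabularProblem S A H) : Prop :=
  ∀ᵐ E ∂M.prior, ∀ (h : Fin H) (s : S) (a : A), ((h : ℕ) = 0 → s = M.init) →
    occupancy E (M.optPolicy E) M.init h s a ≠ 0

variable [MeasurableSpace S] [MeasurableSpace A] {Ω : Type w} [MeasurableSpace Ω]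

/-- The first `ℓ` episodes, the data available before episode number `ℓ` (episodes are numbered
from `0`). -/
def history (tr : ℕ → Ω → Traj S A H) (ℓ : ℕ) : Ω → (Fin ℓ → Traj S A H) :=
  fun ω i => tr i ω

/-- On the probability space `(Ω, μ)`, `env` is the true environment, `sample ℓ` is the
environment sampled by Thompson sampling before episode `ℓ` and `tr ℓ` is the history of
episode `ℓ`. -/
structure IsThompsonSampling (M : TabularProblem S A H) (μ : Measure Ω)
    (env : Ω → Env S A H) (sample : ℕ → Ω → Env S A H) (tr : ℕ → Ω → Traj S A H) : Prop where
  measurable_env : Measurable env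
  measurable_sample : ∀ ℓ, Measurable (sample ℓ)
  measurable_tr : ∀ ℓ, Measurable (tr ℓ)
  /-- the true environment is drawn from the prior -/
  law_env : μ.map env = M.prior
  /-- given the true environment and the past episodes, the sampled environment is drawn from the
  posterior, the conditional law of the true environment given the past episodes -/
  law_sample : ∀ ℓ, ∀ B : Set (Env S A H), MeasurableSet B →
    μ⟦sample ℓ ⁻¹' B | MeasurableSpace.comap env inferInstance ⊔
        MeasurableSpace.comap (history tr ℓ) inferInstance⟧
      =ᵐ[μ] μ⟦env ⁻¹' B | MeasurableSpace.comap (history tr ℓ) inferInstance⟧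
  /-- given the true environment, the past episodes and the sampled environment, the episode is
  run in the true environment with the optimal policy of the sampled environment -/
  law_tr : ∀ ℓ, ∀ B : Set (Traj S A H), MeasurableSet B →
    μ⟦tr ℓ ⁻¹' B | MeasurableSpace.comap env inferInstance ⊔
        MeasurableSpace.comap (history tr ℓ) inferInstance ⊔
        MeasurableSpace.comap (sample ℓ) inferInstance⟧
      =ᵐ[μ] fun ω => (trajLaw (env ω) (M.optPolicy (sample ℓ ω)) M.init).real B

/-- Existence of a strongly consistent estimator of the true environment given the history. It
has to recover, for almost every environment and almost every infinite history, whatever can show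
up in histories: at the first layer only the initial state occurs, and the state reached after
the last layer is not part of the history. -/
def HasConsistentEstimator (M : TabularProblem S A H) (μ : Measure Ω)
    (env : Ω → Env S A H) (tr : ℕ → Ω → Traj S A H) : Prop :=
  ∃ est : (ℓ : ℕ) → (Fin ℓ → Traj S A H) → Env S A H,
    (∀ ℓ, Measurable (est ℓ)) ∧
    ∀ᵐ ω ∂μ, ∀ (h : Fin H) (s : S) (a : A), ((h : ℕ) = 0 → s = M.init) →
      Tendsto (fun ℓ => (est ℓ (history tr ℓ ω)).2 h s a) atTop (𝓝 ((env ω).2 h s a)) ∧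
      ((h : ℕ) + 1 < H →
        Tendsto (fun ℓ => (est ℓ (history tr ℓ ω)).1 h s a) atTop (𝓝 ((env ω).1 h s a)))

/-- The Bayesian regret of Thompson sampling over `L` episodes. -/
def bayesRegret (M : TabularProblem S A H) (μ : Measure Ω)
    (env : Ω → Env S A H) (sample : ℕ → Ω → Env S A H) (L : ℕ) : ℝ :=
  ∑ ℓ ∈ Finset.range L,
    ∫ ω, (M.optValue (env ω) 0 M.init
      - value (env ω) (M.optPolicy (sample ℓ ω)) 0 M.init) ∂μ

end TabularProblem

end BayesRL

end

/-! Since `L₀` may depend on the problem, it suffices that the regret of a fixed problem is `o(√(L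
log L))` and that `λ > 0`: all factors in `H`, `|S|`, `|A|` are then absorbed for large `L`.
Positivity (`valueDiameter_pos`) holds because absolutely continuous rewards have no atoms, hence a
nondegenerate range.

Given the data, the sampled and the true environment have the same law (`map_history_sample`), so in
expectation the optimal value of the true environment may be replaced by that of the sample. The
regret becomes the difference of the values of one policy in two models, and the simulation lemma
`abs_pathExp_sub_le` bounds it by the parameter errors met along the episode actually played
(`integral_regret_le`).

For a parameter with `n` earlier visits, `n` times the error is a difference of two total
deviations: of the observations from the true and from the sampled value. Each has the same joint
law with the data, so only the true one needs control. It is a martingale `X` with bounded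
increments, and `N` visits give `E[X⁴/(N+1)²] = O(log L)` (`integral_pow_four_div_le`). The
inequality `x ≤ a + x⁴/a³` with `a = c (n+1)^(-2/3)` splits the errors into weights that sum to `O(c
L^(1/3))` along every history and a remainder `O(L log L / c³)`. The choice `c = L^(1/6) (log
L)^(1/4)` yields `√L (log L)^(1/4)`. The same scheme with second moments would yield `√L log L`,
which is too large. -/

noncomputable section

namespace BayesRL

universe u v w

set_option synthInstance.maxSize 1000
set_option linter.unusedSectionVars false

/-! ### Expectations along state-action paths and the simulation lemma. -/

section Paths

variable {S : Type u} {A : Type v} [Fintype S] [Fintype A]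

/-- Expectation of a function of the state-action sequence of an episode of `n` layers. -/
def pathExp (n : ℕ) (P : Fin n → Transition S A) (π : Policy S A n) (s : S)
    (F : (Fin n → S × A) → ℝ) : ℝ :=
  ∑ τ, pathProb n P π s τ * F τ

theorem pathProb_nonneg (n : ℕ) (P : Fin n → Transition S A) (π : Policy S A n) (s : S)
    (τ : Fin n → S × A) : 0 ≤ pathProb n P π s τ := by
  induction n generalizing s with
  | zero => simp [pathProb]
  | succ n ih =>
    rw [pathProb]
    refine mul_nonneg (mul_nonneg (by split_ifs <;> simp) ((π 0 s).2.1 _))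
      (Finset.sum_nonneg fun s' _ => mul_nonneg ((P 0 s _).2.1 _) (ih _ _ _ _))

theorem pathExp_zero (P : Fin 0 → Transition S A) (π : Policy S A 0) (s : S)
    (F : (Fin 0 → S × A) → ℝ) : pathExp 0 P π s F = F default := by
  simp [pathExp, pathProb, Subsingleton.elim _ (default : Fin 0 → S × A)]

/-- Conditioning on the first action and the state it leads to. This recursion drives all inductions
on the episode length. -/
theorem pathExp_succ (n : ℕ) (P : Fin (n + 1) → Transition S A) (π : Policy S A (n + 1)) (s : S)
    (F : (Fin (n + 1) → S × A) → ℝ) :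
    pathExp (n + 1) P π s F =
      ∑ a, (π 0 s).1 a * ∑ s', (P 0 s a).1 s' *
        pathExp n (Fin.tail P) (Fin.tail π) s' (fun τ => F (Fin.cons (s, a) τ)) := by
  classical
  rw [pathExp, ← (Fin.consEquiv (fun _ : Fin (n + 1) => S × A)).sum_comp, Fintype.sum_prod_type,
    Fintype.sum_prod_type, Finset.sum_eq_single s]
  · refine Finset.sum_congr rfl fun a _ => ?_
    simp only [Fin.consEquiv, Equiv.coe_fn_mk, pathProb, Fin.cons_zero, if_true, one_mul,
      Fin.tail_cons, pathExp, Finset.mul_sum, Finset.sum_mul]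
    rw [Finset.sum_comm]
    exact Finset.sum_congr rfl fun _ _ => Finset.sum_congr rfl fun _ _ => by ring
  · intro s' _ hs'
    simp [Fin.consEquiv, pathProb, hs']
  · simp

theorem pathExp_mono {n : ℕ} (P : Fin n → Transition S A) (π : Policy S A n) (s : S)
    {F G : (Fin n → S × A) → ℝ} (h : ∀ τ, F τ ≤ G τ) : pathExp n P π s F ≤ pathExp n P π s G :=
  Finset.sum_le_sum fun τ _ => mul_le_mul_of_nonneg_left (h τ) (pathProb_nonneg _ _ _ _ _)

theorem pathExp_add {n : ℕ} (P : Fin n → Transition S A) (π : Policy S A n) (s : S)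
    (F G : (Fin n → S × A) → ℝ) :
    pathExp n P π s (fun τ => F τ + G τ) = pathExp n P π s F + pathExp n P π s G := by
  simp [pathExp, mul_add, Finset.sum_add_distrib]

theorem pathExp_const (n : ℕ) (P : Fin n → Transition S A) (π : Policy S A n) (s : S) (c : ℝ) :
    pathExp n P π s (fun _ => c) = c := by
  induction n generalizing s with
  | zero => rw [pathExp_zero]
  | succ n ih =>
    rw [pathExp_succ]
    simp [ih, ← Finset.sum_mul, (P 0 s _).2.2, (π 0 s).2.2]

theorem sum_pathProb (n : ℕ) (P : Fin n → Transition S A) (π : Policy S A n) (s : S) :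
    ∑ τ, pathProb n P π s τ = 1 := by
  simpa [pathExp] using pathExp_const n P π s 1

theorem pathExp_succ_sum (n : ℕ) (P : Fin (n + 1) → Transition S A) (π : Policy S A (n + 1))
    (s : S) (g : Fin (n + 1) → S → A → ℝ) :
    pathExp (n + 1) P π s (fun τ => ∑ i, g i (τ i).1 (τ i).2) =
      ∑ a, (π 0 s).1 a * (g 0 s a + ∑ s', (P 0 s a).1 s' *
        pathExp n (Fin.tail P) (Fin.tail π) s' (fun τ => ∑ i, Fin.tail g i (τ i).1 (τ i).2)) := by
  rw [pathExp_succ]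
  refine Finset.sum_congr rfl fun a _ => ?_
  congr 1
  simp only [Fin.sum_univ_succ, Fin.cons_zero, Fin.cons_succ, pathExp_add, pathExp_const, mul_add,
    Finset.sum_add_distrib, ← Finset.sum_mul, (P 0 s a).2.2, one_mul]
  rfl

theorem pathExp_sum_mem_Icc {n : ℕ} (P : Fin n → Transition S A) (π : Policy S A n) (s : S)
    {R : Fin n → S → A → ℝ} (hR : ∀ i s a, R i s a ∈ Set.Icc (0 : ℝ) 1) :
    pathExp n P π s (fun τ => ∑ i, R i (τ i).1 (τ i).2) ∈ Set.Icc (0 : ℝ) n := by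
  constructor
  · rw [← pathExp_const n P π s 0]
    exact pathExp_mono _ _ _ fun τ => Finset.sum_nonneg fun i _ => (hR _ _ _).1
  · rw [← pathExp_const n P π s n]
    refine pathExp_mono _ _ _ fun τ => ?_
    refine (Finset.sum_le_sum fun i _ => (hR i _ _).2).trans ?_
    simp

/-- The discrepancy of two models at layer `i`; the transitions of the last layer do not matter,
the other ones get the weight `K`. -/
def modelGap (K : ℝ) {n : ℕ} (P P' : Fin n → Transition S A) (R R' : Fin n → S → A → ℝ)
    (i : Fin n) (s : S) (a : A) : ℝ :=
  |R' i s a - R i s a| +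
    K * if (i : ℕ) + 1 < n then ∑ s', |(P' i s a).1 s' - (P i s a).1 s'| else 0

/-- Simulation lemma: the values of one policy in two models differ by at most the expected
differences of the models along an episode of the second one. -/
theorem abs_pathExp_sub_le (n : ℕ) (P P' : Fin n → Transition S A) (R R' : Fin n → S → A → ℝ)
    (hR' : ∀ i s a, R' i s a ∈ Set.Icc (0 : ℝ) 1) (K : ℝ) (hK : n ≤ K) (π : Policy S A n) (s : S) :
    |pathExp n P' π s (fun τ => ∑ i, R' i (τ i).1 (τ i).2) -
        pathExp n P π s (fun τ => ∑ i, R i (τ i).1 (τ i).2)| ≤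
      pathExp n P π s (fun τ => ∑ i, modelGap K P P' R R' i (τ i).1 (τ i).2) := by
  induction n generalizing s with
  | zero => simp [pathExp_zero]
  | succ n ih =>
    rw [pathExp_succ_sum, pathExp_succ_sum, pathExp_succ_sum, ← Finset.sum_sub_distrib]
    refine (Finset.abs_sum_le_sum_abs _ _).trans (Finset.sum_le_sum fun a _ => ?_)
    rw [← mul_sub, abs_mul, abs_of_nonneg ((π 0 s).2.1 a)]
    refine mul_le_mul_of_nonneg_left ?_ ((π 0 s).2.1 a)
    set V' := fun s' => pathExp n (Fin.tail P') (Fin.tail π) s'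
      (fun τ => ∑ i, Fin.tail R' i (τ i).1 (τ i).2)
    set V := fun s' => pathExp n (Fin.tail P) (Fin.tail π) s'
      (fun τ => ∑ i, Fin.tail R i (τ i).1 (τ i).2)
    have hV' : ∀ s', V' s' ∈ Set.Icc (0 : ℝ) n := fun s' =>
      pathExp_sum_mem_Icc _ _ _ fun i s a => hR' i.succ s a
    have hnK : (n : ℝ) ≤ K := by push_cast at hK; linarith
    -- The transition gap is tested against `V'`, which is bounded, while the remaining value gap is
    -- propagated by `P`. Hence the final expectation is taken in the unprimed model.
    have key : R' 0 s a + ∑ s', (P' 0 s a).1 s' * V' s' - (R 0 s a + ∑ s', (P 0 s a).1 s' * V s')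
        = (R' 0 s a - R 0 s a) + ∑ s', ((P' 0 s a).1 s' - (P 0 s a).1 s') * V' s' +
          ∑ s', (P 0 s a).1 s' * (V' s' - V s') := by
      simp only [sub_mul, mul_sub, Finset.sum_sub_distrib]; ring
    have h1 : |∑ s', ((P' 0 s a).1 s' - (P 0 s a).1 s') * V' s'| ≤
        K * if ((0 : Fin (n + 1)) : ℕ) + 1 < n + 1 then
          ∑ s', |(P' 0 s a).1 s' - (P 0 s a).1 s'| else 0 := by
      split_ifs with hn
      · rw [Finset.mul_sum]
        refine (Finset.abs_sum_le_sum_abs _ _).trans (Finset.sum_le_sum fun s' _ => ?_)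
        rw [abs_mul, mul_comm, abs_of_nonneg (hV' s').1]
        exact mul_le_mul_of_nonneg_right ((hV' s').2.trans hnK) (abs_nonneg _)
      -- At the last layer nothing follows, so `V'` vanishes and the transition gap is free. This
      -- matters because histories do not show the state after the last layer.
      · have hn0 : n = 0 := by simpa using hn
        have : ∀ s', V' s' = 0 := fun s' =>
          le_antisymm ((hV' s').2.trans (by simp [hn0])) (hV' s').1
        simp [this]
    have h2 : |∑ s', (P 0 s a).1 s' * (V' s' - V s')| ≤ ∑ s', (P 0 s a).1 s' *
        pathExp n (Fin.tail P) (Fin.tail π) s' (fun τ => ∑ i,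
          Fin.tail (modelGap K P P' R R') i (τ i).1 (τ i).2) := by
      refine (Finset.abs_sum_le_sum_abs _ _).trans (Finset.sum_le_sum fun s' _ => ?_)
      rw [abs_mul, abs_of_nonneg ((P 0 s a).2.1 s')]
      refine mul_le_mul_of_nonneg_left ?_ ((P 0 s a).2.1 s')
      refine (ih (Fin.tail P) (Fin.tail P') (Fin.tail R) (Fin.tail R')
        (fun i s a => hR' i.succ s a) hnK (Fin.tail π) s').trans (le_of_eq ?_)
      simp [Fin.tail, modelGap]
    rw [key]
    rw [modelGap]
    exact (abs_add_three _ _ _).trans (add_le_add (add_le_add le_rfl h1) h2)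

open Classical in
/-- The next state is distributed according to the transition function. -/
theorem pathExp_transition (n : ℕ) (P : Fin n → Transition S A) (π : Policy S A n) (s₀ : S)
    (h : ℕ) (hh : h + 1 < n) (s : S) (a : A) (s' : S) :
    pathExp n P π s₀ (fun τ => if τ ⟨h, by omega⟩ = (s, a) then
      (if (τ ⟨h + 1, hh⟩).1 = s' then 1 else 0) - (P ⟨h, by omega⟩ s a).1 s' else 0) = 0 := by
  induction n generalizing s₀ h with
  | zero => omega
  | succ n ih =>
    rw [pathExp_succ]
    refine Finset.sum_eq_zero fun b _ => ?_
    cases h with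
    | zero =>
      obtain ⟨m, rfl⟩ : ∃ m, n = m + 1 := ⟨n - 1, by omega⟩
      have e0 : (⟨0, by omega⟩ : Fin (m + 1 + 1)) = 0 := rfl
      have e1 : (⟨0 + 1, hh⟩ : Fin (m + 1 + 1)) = Fin.succ 0 := rfl
      simp only [e0, e1, Fin.cons_zero, Fin.cons_succ]
      by_cases hsa : (s₀, b) = (s, a)
      · obtain ⟨rfl, rfl⟩ := Prod.mk.inj hsa
        have : ∀ t, pathExp (m + 1) (Fin.tail P) (Fin.tail π) t
            (fun τ => (if (τ 0).1 = s' then (1 : ℝ) else 0) - (P 0 s₀ b).1 s') =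
            (if t = s' then 1 else 0) - (P 0 s₀ b).1 s' := by
          intro t
          rw [pathExp_succ]
          simp only [Fin.cons_zero, pathExp_const, ← Finset.sum_mul, (Fin.tail P 0 t _).2.2,
            (Fin.tail π 0 t).2.2, one_mul]
        simp only [if_true, this, mul_sub, Finset.sum_sub_distrib, ← Finset.sum_mul,
          (P 0 s₀ b).2.2]
        simp
      · simp only [if_neg hsa, pathExp_const]
        simp
    | succ h =>
      have := fun t => ih (Fin.tail P) (Fin.tail π) t h (by omega)
      have e1 : (⟨h + 1, by omega⟩ : Fin (n + 1)) = Fin.succ ⟨h, by omega⟩ := rfl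
      have e2 : (⟨h + 1 + 1, hh⟩ : Fin (n + 1)) = Fin.succ ⟨h + 1, by omega⟩ := rfl
      simp only [e1, e2, Fin.cons_succ]
      simp only [Fin.tail] at this
      simp only [this]
      simp

end Paths

/-! ### Deterministic inequalities: the potential, the visit weights and the choice of the
parameter. -/

section Scalar

/-- A potential for the deviation `x` of a sum of `n` bounded martingale differences. -/
def devPotential (x n : ℝ) : ℝ :=
  x ^ 4 / (n + 1) ^ 2 + 8 * (x ^ 2 / (n + 1)) - 11 * Real.log (n + 1)

/-- The coefficient of the next martingale difference in the increment of `devPotential`. -/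
def devSlope (x n : ℝ) : ℝ := 4 * x ^ 3 / (n + 2) ^ 2 + 16 * x / (n + 2)

/-- With `N = n + 1`, a visit raises the quartic term, apart from its part linear in `ξ`, by at most
`8x²/(N(N+1)) + 3/(N+1)`. The growing denominator of the quadratic term gives back `x²/(N(N+1))`, so
the factor `8` cancels the first summand at the price of `8/(N+1)`. The total `11/(N+1)` is
compensated by the logarithm. -/
theorem devPotential_step {x n ξ v : ℝ} (hn : 0 ≤ n) (hv : v = 0 ∨ v = 1) (hξ : |ξ| ≤ v) :
    devPotential (x + ξ) (n + v) ≤ devPotential x n + devSlope x n * ξ := by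
  rcases hv with rfl | rfl
  · have : ξ = 0 := abs_eq_zero.1 (le_antisymm hξ (abs_nonneg _))
    simp [this]
  · obtain ⟨h1, h2⟩ := abs_le.1 hξ
    have hsq : ξ ^ 2 ≤ 1 := by nlinarith
    unfold devPotential devSlope
    obtain ⟨N, rfl⟩ : ∃ N, n = N - 1 := ⟨n + 1, by ring⟩
    have hN : 1 ≤ N := by linarith
    have e1 : N - 1 + 1 + 1 = N + 1 := by ring
    have e2 : N - 1 + 1 = N := by ring
    have e3 : N - 1 + 2 = N + 1 := by ring
    rw [e1, e2, e3]
    have hlog : 1 / (N + 1) ≤ Real.log (N + 1) - Real.log N := by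
      have h := Real.one_sub_inv_le_log_of_pos (show 0 < (N + 1) / N by positivity)
      rw [Real.log_div (by positivity) (by positivity)] at h
      refine le_trans (le_of_eq ?_) h
      field_simp
      ring
    have hA : (x + ξ) ^ 4 - 4 * x ^ 3 * ξ ≤ x ^ 4 + 8 * x ^ 2 + 3 := by
      have a1 : x ^ 2 * ξ ^ 2 ≤ x ^ 2 := by nlinarith [sq_nonneg x]
      have a2 : ξ ^ 4 ≤ 1 := by nlinarith [sq_nonneg ξ]
      have a3 : 2 * (x * ξ ^ 3) ≤ x ^ 2 + 1 := by
        nlinarith [sq_nonneg (x - ξ ^ 3), sq_nonneg ξ, mul_nonneg (sq_nonneg ξ) (sq_nonneg ξ)]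
      nlinarith
    have hB : (x + ξ) ^ 2 - 2 * x * ξ ≤ x ^ 2 + 1 := by nlinarith
    have hA' : ((x + ξ) ^ 4 - 4 * x ^ 3 * ξ) / (N + 1) ^ 2 ≤
        x ^ 4 / N ^ 2 + 8 * x ^ 2 / (N * (N + 1)) + 3 / (N + 1) := by
      refine (div_le_div_of_nonneg_right hA (by positivity)).trans ?_
      rw [add_div, add_div]
      refine add_le_add (add_le_add ?_ ?_) ?_
      · gcongr; linarith
      · refine div_le_div_of_nonneg_left (by positivity) (by positivity) (by nlinarith)
      · refine div_le_div_of_nonneg_left (by positivity) (by positivity) (by nlinarith)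
    have hB' : ((x + ξ) ^ 2 - 2 * x * ξ) / (N + 1) ≤
        x ^ 2 / N - x ^ 2 / (N * (N + 1)) + 1 / (N + 1) := by
      refine (div_le_div_of_nonneg_right hB (by positivity)).trans (le_of_eq ?_)
      field_simp
      ring
    have i1 : (x + ξ) ^ 4 / (N + 1) ^ 2 =
        ((x + ξ) ^ 4 - 4 * x ^ 3 * ξ) / (N + 1) ^ 2 + 4 * x ^ 3 / (N + 1) ^ 2 * ξ := by ring
    have i2 : (x + ξ) ^ 2 / (N + 1) =
        ((x + ξ) ^ 2 - 2 * x * ξ) / (N + 1) + 2 * (x / (N + 1) * ξ) := by ring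
    have i3 : 8 * x ^ 2 / (N * (N + 1)) = 8 * (x ^ 2 / (N * (N + 1))) := by ring
    have i4 : 3 / (N + 1) = 3 * (1 / (N + 1)) := by ring
    have i5 : 16 * x / (N + 1) * ξ = 16 * (x / (N + 1) * ξ) := by ring
    rw [i3, i4] at hA'
    rw [i1, i2, add_mul, i5]
    linarith

/-- Weights decaying like `n ^ (-2/3)` in the number `n` of earlier visits telescope. -/
theorem visitWeight_step {n v : ℝ} (hn : 0 ≤ n) (hv : v = 0 ∨ v = 1) :
    v * (((n + 1) ^ (1 / 3 : ℝ)) ^ 2)⁻¹ ≤ 3 * (n + v) ^ (1 / 3 : ℝ) - 3 * n ^ (1 / 3 : ℝ) := by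
  rcases hv with rfl | rfl
  · simp
  · set y := (n + 1) ^ (1 / 3 : ℝ)
    set x := n ^ (1 / 3 : ℝ)
    have hy : 0 < y := by positivity
    have hx : 0 ≤ x := by positivity
    have hxy : x ≤ y := Real.rpow_le_rpow hn (by linarith) (by norm_num)
    have hy3 : y ^ 3 = n + 1 := by
      rw [← Real.rpow_natCast, ← Real.rpow_mul (by positivity)]; norm_num
    have hx3 : x ^ 3 = n := by
      rw [← Real.rpow_natCast, ← Real.rpow_mul (by positivity)]; norm_num
    rw [one_mul, inv_le_iff_one_le_mul₀ (by positivity)]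
    -- `1 = y³ - x³ = (y - x)(y² + xy + x²) ≤ 3y²(y - x)`.
    nlinarith [mul_nonneg (sub_nonneg.2 hxy) (mul_nonneg hx hy.le),
      mul_nonneg (sub_nonneg.2 hxy) (sub_nonneg.2 hxy), mul_nonneg (sub_nonneg.2 hxy) hx,
      mul_nonneg (mul_nonneg (sub_nonneg.2 hxy) (sub_nonneg.2 hxy)) hx,
      mul_nonneg (mul_nonneg (sub_nonneg.2 hxy) (sub_nonneg.2 hxy)) hy.le]

theorem le_add_pow_four_div {x a : ℝ} (hx : 0 ≤ x) (ha : 0 < a) : x ≤ a + x ^ 4 / a ^ 3 := by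
  rcases le_total x a with h | h
  · have : 0 ≤ x ^ 4 / a ^ 3 := by positivity
    linarith
  · have : x ≤ x ^ 4 / a ^ 3 := by
      rw [le_div_iff₀ (by positivity)]
      calc x * a ^ 3 ≤ x * x ^ 3 := by gcongr
        _ = x ^ 4 := by ring
    linarith

/-- The error `d` is at most `f/(n+1) + g/(n+1) + 1/(n+1)`, and `le_add_pow_four_div` applies to the
first two terms with `a = c (n+1)^(-2/3)`. This exponent makes the remainder exactly the
self-normalized quantity `f⁴/(n+1)²`. The third term is below `(n+1)^(-2/3)` and accounts for the
`1` in `2 * c + 1`. -/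
theorem visit_mul_abs_le {n v d f g c : ℝ} (hn : 0 ≤ n) (hv : v = 0 ∨ v = 1) (hc : 0 < c)
    (hf : 0 ≤ f) (hg : 0 ≤ g) (h : (n + 1) * |d| ≤ f + g + 1) :
    v * |d| ≤ (2 * c + 1) * (v * (((n + 1) ^ (1 / 3 : ℝ)) ^ 2)⁻¹) +
      (f ^ 4 / (n + 1) ^ 2 + g ^ 4 / (n + 1) ^ 2) / c ^ 3 := by
  rcases hv with rfl | rfl
  · simp only [zero_mul, mul_zero, zero_add]
    positivity
  · set y := (n + 1) ^ (1 / 3 : ℝ)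
    have hy : 1 ≤ y := Real.one_le_rpow (by linarith) (by norm_num)
    have hy3 : n + 1 = y ^ 3 := by
      rw [← Real.rpow_natCast, ← Real.rpow_mul (by positivity)]; norm_num
    rw [hy3] at h ⊢
    have hy0 : 0 < y := by linarith
    have hF := le_add_pow_four_div (x := f / y ^ 3) (a := c * (y ^ 2)⁻¹) (by positivity)
      (by positivity)
    have hG := le_add_pow_four_div (x := g / y ^ 3) (a := c * (y ^ 2)⁻¹) (by positivity)
      (by positivity)
    have e : ∀ z : ℝ, (z / y ^ 3) ^ 4 / (c * (y ^ 2)⁻¹) ^ 3 = z ^ 4 / (y ^ 3) ^ 2 / c ^ 3 := by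
      intro z; field_simp
    have h1 : 1 / y ^ 3 ≤ (y ^ 2)⁻¹ := by
      rw [inv_eq_one_div]
      exact div_le_div_of_nonneg_left (by norm_num) (by positivity)
        (pow_le_pow_right₀ hy (by norm_num))
    have h2 : |d| ≤ f / y ^ 3 + g / y ^ 3 + 1 / y ^ 3 := by
      rw [← add_div, ← add_div, le_div_iff₀ (by positivity)]
      linarith
    rw [e] at hF hG
    rw [add_div, one_mul, one_mul]
    nlinarith

/-- The estimate per feature that is obtained with the parameter `c` in `visit_mul_abs_le`. -/
def featureBound (c : ℝ) (L : ℕ) : ℝ :=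
  (2 * c + 1) * (3 * (L : ℝ) ^ (1 / 3 : ℝ)) + L * (2 * (11 * Real.log (L + 1)) / c ^ 3)

/-- With an optimal choice of the parameter, the estimate is of smaller order than
`√(L log L)`. -/
theorem eventually_featureBound_le (K lam : ℝ) (hK : 0 ≤ K) (hlam : 0 < lam) :
    ∀ᶠ L : ℕ in atTop, ∃ c : ℝ, 0 < c ∧
      K * featureBound c L ≤ lam * √(L : ℝ) * √(Real.log L) := by
  have hlim : Tendsto (fun L : ℕ => (Real.log (L : ℝ)) ^ (1 / 4 : ℝ)) atTop atTop :=
    (tendsto_rpow_atTop (by norm_num)).comp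
      (Real.tendsto_log_atTop.comp tendsto_natCast_atTop_atTop)
  -- The bound has size `53 K √L (log L)^(1/4)`, with `53 = 9 + 44` from the two summands, so a
  -- further factor `(log L)^(1/4) ≥ 53 K / lam` suffices.
  filter_upwards [hlim.eventually_ge_atTop (max 1 (53 * K / lam)), eventually_ge_atTop 2]
    with L hL hL2
  have hL2' : (2 : ℝ) ≤ L := by exact_mod_cast hL2
  set l := Real.log (L : ℝ) with hl
  set t := l ^ (1 / 4 : ℝ) with ht
  set x := (L : ℝ) ^ (1 / 6 : ℝ) with hx
  have hl0 : 0 ≤ l := Real.log_nonneg (by linarith)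
  have ht1 : 1 ≤ t := (le_max_left _ _).trans hL
  have hx1 : 1 ≤ x := Real.one_le_rpow (by linarith) (by norm_num)
  have ht4 : l = t ^ 4 := by
    rw [ht, ← Real.rpow_natCast, ← Real.rpow_mul hl0]; norm_num
  have hx6 : (L : ℝ) = x ^ 6 := by
    rw [hx, ← Real.rpow_natCast, ← Real.rpow_mul (by positivity)]; norm_num
  have hx2 : (L : ℝ) ^ (1 / 3 : ℝ) = x ^ 2 := by
    rw [hx, ← Real.rpow_natCast, ← Real.rpow_mul (by positivity)]; norm_num
  -- `L + 1 ≤ L²` for `L ≥ 2`.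
  have hlogL : Real.log (L + 1) ≤ 2 * t ^ 4 := by
    rw [← ht4, hl, ← Real.log_rpow (by linarith)]
    refine Real.log_le_log (by positivity) ?_
    rw [Real.rpow_two]
    nlinarith
  have hsL : √(L : ℝ) = x ^ 3 := by
    rw [hx6, show x ^ 6 = (x ^ 3) ^ 2 by ring, Real.sqrt_sq (by positivity)]
  have hsl : √l = t ^ 2 := by
    rw [ht4, show t ^ 4 = (t ^ 2) ^ 2 by ring, Real.sqrt_sq (by positivity)]
  -- This choice balances `c L^(1/3)` and `L log L / c³`: both have order `x³ t = √L (log L)^(1/4)`.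
  refine ⟨x * t, by positivity, ?_⟩
  rw [hsL, hsl, featureBound, hx2]
  have h1 : (L : ℝ) * (2 * (11 * Real.log (L + 1)) / (x * t) ^ 3) ≤ 44 * (x ^ 3 * t) := by
    calc (L : ℝ) * (2 * (11 * Real.log (L + 1)) / (x * t) ^ 3)
        ≤ x ^ 6 * (2 * (11 * (2 * t ^ 4)) / (x * t) ^ 3) := by
          rw [hx6] at hlogL ⊢
          gcongr
      _ = 44 * (x ^ 3 * t) := by field_simp; norm_num
  have h2 : x ^ 2 ≤ x ^ 3 * t := by
    calc x ^ 2 = x ^ 2 * 1 * 1 := by ring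
      _ ≤ x ^ 2 * x * t := by gcongr
      _ = x ^ 3 * t := by ring
  have h3 : (2 * (x * t) + 1) * (3 * x ^ 2) + L * (2 * (11 * Real.log (L + 1)) / (x * t) ^ 3) ≤
      53 * (x ^ 3 * t) := by nlinarith
  have h4 : 53 * K ≤ lam * t := by
    have := (le_max_right _ _).trans hL
    rw [div_le_iff₀ hlam] at this
    linarith
  calc _ ≤ K * (53 * (x ^ 3 * t)) := by gcongr
    _ = (53 * K) * (x ^ 3 * t) := by ring
    _ ≤ (lam * t) * (x ^ 3 * t) := by gcongr
    _ = lam * x ^ 3 * t ^ 2 := by ring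

end Scalar

/-! ### The self-normalized fourth moment bound. -/

section Martingale

variable {Ω : Type w} [MeasurableSpace Ω] {μ : Measure Ω} [IsProbabilityMeasure μ]

theorem measurable_devPotential : Measurable (fun p : ℝ × ℝ => devPotential p.1 p.2) := by
  unfold devPotential; fun_prop

theorem measurable_devSlope : Measurable (fun p : ℝ × ℝ => devSlope p.1 p.2) := by
  unfold devSlope; fun_prop

theorem abs_devPotential_le {x n B : ℝ} (hx : |x| ≤ B) (hn : 0 ≤ n) (hnB : n ≤ B) :
    |devPotential x n| ≤ B ^ 4 + 8 * B ^ 2 + 11 * Real.log (B + 1) := by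
  have hB : 0 ≤ B := hn.trans hnB
  have h2 : x ^ 2 ≤ B ^ 2 := sq_le_sq.2 (by rwa [abs_of_nonneg hB])
  have h4 : x ^ 4 ≤ B ^ 4 := by nlinarith [sq_nonneg x]
  have a1 : x ^ 4 / (n + 1) ^ 2 ≤ B ^ 4 :=
    (div_le_self (by positivity) (one_le_pow₀ (by linarith))).trans h4
  have a2 : x ^ 2 / (n + 1) ≤ B ^ 2 := (div_le_self (by positivity) (by linarith)).trans h2
  have a3 : Real.log (n + 1) ≤ Real.log (B + 1) := Real.log_le_log (by linarith) (by linarith)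
  have a4 : 0 ≤ Real.log (n + 1) := Real.log_nonneg (by linarith)
  have a5 : 0 ≤ x ^ 4 / (n + 1) ^ 2 := by positivity
  have a6 : 0 ≤ x ^ 2 / (n + 1) := by positivity
  have a7 : 0 ≤ B ^ 4 := by positivity
  have a8 : 0 ≤ B ^ 2 := by positivity
  rw [devPotential, abs_le]
  constructor <;> linarith

theorem abs_devSlope_le {x n B : ℝ} (hx : |x| ≤ B) (hn : 0 ≤ n) :
    |devSlope x n| ≤ 4 * B ^ 3 + 16 * B := by
  have hB : 0 ≤ B := (abs_nonneg _).trans hx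
  rw [devSlope]
  refine (abs_add_le _ _).trans (add_le_add ?_ ?_)
  · rw [abs_div, abs_mul, abs_pow, abs_of_nonneg (show (0 : ℝ) ≤ 4 by norm_num),
      abs_of_nonneg (show 0 ≤ (n + 2) ^ 2 by positivity)]
    refine (div_le_self (by positivity) (one_le_pow₀ (by linarith))).trans ?_
    gcongr
  · rw [abs_div, abs_mul, abs_of_nonneg (show (0 : ℝ) ≤ 16 by norm_num),
      abs_of_nonneg (show 0 ≤ n + 2 by positivity)]
    refine (div_le_self (by positivity) (by linarith)).trans ?_
    gcongr

theorem abs_sum_range_le {f g : ℕ → ℝ} (h : ∀ i, |f i| ≤ g i) (hg : ∀ i, g i ≤ 1) (n : ℕ) :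
    |∑ i ∈ Finset.range n, f i| ≤ n := by
  refine (Finset.abs_sum_le_sum_abs _ _).trans ?_
  refine (Finset.sum_le_sum fun i _ => (h i).trans (hg i)).trans ?_
  simp

/-- Self-normalized fourth moment bound: if the martingale differences `ξ` vanish without a visit
and are bounded by `1`, then the fourth moment of their sum is of the order of the squared number
of visits, up to a logarithm. -/
theorem integral_pow_four_div_le (ξ v : ℕ → Ω → ℝ) (hξm : ∀ i, Measurable (ξ i))
    (hvm : ∀ i, Measurable (v i)) (hv : ∀ i ω, v i ω = 0 ∨ v i ω = 1)
    (hξ : ∀ i ω, |ξ i ω| ≤ v i ω)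
    (hmart : ∀ n, ∫ ω, devSlope (∑ i ∈ Finset.range n, ξ i ω) (∑ i ∈ Finset.range n, v i ω) *
      ξ n ω ∂μ = 0) (n : ℕ) :
    ∫ ω, (∑ i ∈ Finset.range n, ξ i ω) ^ 4 / (∑ i ∈ Finset.range n, v i ω + 1) ^ 2 ∂μ ≤
      11 * Real.log (n + 1) := by
  set X : ℕ → Ω → ℝ := fun n ω => ∑ i ∈ Finset.range n, ξ i ω with hX
  set N : ℕ → Ω → ℝ := fun n ω => ∑ i ∈ Finset.range n, v i ω with hN
  have hv0 : ∀ i ω, 0 ≤ v i ω := fun i ω => (abs_nonneg _).trans (hξ i ω)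
  have hv1 : ∀ i ω, v i ω ≤ 1 := fun i ω => by rcases hv i ω with h | h <;> rw [h]; norm_num
  have hXm : ∀ n, Measurable (X n) := fun n => Finset.measurable_sum _ fun i _ => hξm i
  have hNm : ∀ n, Measurable (N n) := fun n => Finset.measurable_sum _ fun i _ => hvm i
  have hXb : ∀ n ω, |X n ω| ≤ n := fun n ω => abs_sum_range_le (fun i => hξ i ω) (hv1 · ω) n
  have hN0 : ∀ n ω, 0 ≤ N n ω := fun n ω => Finset.sum_nonneg fun i _ => hv0 i ω
  have hNb : ∀ n ω, N n ω ≤ n := fun n ω =>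
    (le_abs_self _).trans (abs_sum_range_le (fun i => (abs_of_nonneg (hv0 i ω)).le) (hv1 · ω) n)
  have hpot : ∀ n, Integrable (fun ω => devPotential (X n ω) (N n ω)) μ := fun n =>
    Integrable.of_bound (measurable_devPotential.comp ((hXm n).prodMk (hNm n))).aestronglyMeasurable
      _ (ae_of_all _ fun ω => abs_devPotential_le (hXb n ω) (hN0 n ω) (hNb n ω))
  have hslope : ∀ n, Integrable (fun ω => devSlope (X n ω) (N n ω) * ξ n ω) μ := fun n => by
    refine Integrable.of_bound ((measurable_devSlope.comp
      ((hXm n).prodMk (hNm n))).mul (hξm n)).aestronglyMeasurable (4 * (n : ℝ) ^ 3 + 16 * n)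
      (ae_of_all _ fun ω => ?_)
    rw [Real.norm_eq_abs, abs_mul]
    refine (mul_le_of_le_one_right (abs_nonneg _) ((hξ n ω).trans (hv1 n ω))).trans ?_
    exact abs_devSlope_le (hXb n ω) (hN0 n ω)
  -- The potential starts at zero and does not increase in expectation. Orthogonality of `ξ n` to
  -- this one slope is all that is needed, so no filtration enters.
  have hle : ∀ n, ∫ ω, devPotential (X n ω) (N n ω) ∂μ ≤ 0 := by
    intro n
    induction n with
    | zero => simp [hX, hN, devPotential]
    | succ n ih =>
      refine le_trans ?_ ih
      have : ∫ ω, devPotential (X n ω) (N n ω) ∂μ =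
          ∫ ω, (devPotential (X n ω) (N n ω) + devSlope (X n ω) (N n ω) * ξ n ω) ∂μ := by
        rw [integral_add (hpot n) (hslope n), hmart n, add_zero]
      rw [this]
      refine integral_mono (hpot _) ((hpot n).add (hslope n)) fun ω => ?_
      simp only [hX, hN, Finset.sum_range_succ]
      exact devPotential_step (hN0 n ω) (hv n ω) (hξ n ω)
  -- Drop the nonnegative quadratic term and use `N ≤ n` in the logarithm.
  have hmono : ∫ ω, (X n ω) ^ 4 / (N n ω + 1) ^ 2 ∂μ ≤
      ∫ ω, (devPotential (X n ω) (N n ω) + 11 * Real.log (n + 1)) ∂μ := by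
    refine integral_mono_of_nonneg (ae_of_all _ fun ω => by simp only [Pi.zero_apply]; positivity)
      ((hpot n).add (integrable_const _)) (ae_of_all _ fun ω => ?_)
    have h1 := Real.log_le_log (show 0 < N n ω + 1 by linarith [hN0 n ω])
      (show N n ω + 1 ≤ n + 1 by linarith [hNb n ω])
    have h2 : 0 ≤ X n ω ^ 2 / (N n ω + 1) :=
      div_nonneg (sq_nonneg _) (by linarith [hN0 n ω])
    simp only [devPotential]
    linarith
  rw [integral_add (hpot n) (integrable_const _)] at hmono
  simp only [integral_const, probReal_univ, one_smul] at hmono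
  linarith [hle n]

end Martingale

/-! ### Means and essential bounds of reward distributions. -/

section RewardLaws

theorem ae_mem_Icc (m : RewardLaw) : ∀ᵐ x ∂(m.1 : Measure ℝ), x ∈ Set.Icc (0 : ℝ) 1 :=
  m.2.ae_le (ae_restrict_mem measurableSet_Icc)

theorem measurable_toMeasure : Measurable (fun m : RewardLaw => (m.1 : Measure ℝ)) :=
  measurable_subtype_coe.comp measurable_subtype_coe

/-- The rewards as a kernel. -/
def rewardKernel : Kernel RewardLaw ℝ := ⟨fun m => (m.1 : Measure ℝ), measurable_toMeasure⟩

instance : IsMarkovKernel rewardKernel :=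
  ⟨fun m => inferInstanceAs (IsProbabilityMeasure (m.1 : Measure ℝ))⟩

theorem measurable_meanReward : Measurable meanReward :=
  ((StronglyMeasurable.integral_kernel (κ := rewardKernel)
    stronglyMeasurable_id)).measurable

theorem meanReward_mem_Icc (m : RewardLaw) : meanReward m ∈ Set.Icc (0 : ℝ) 1 := by
  have hint : Integrable (fun x : ℝ => x) (m.1 : Measure ℝ) := by
    refine Integrable.of_bound measurable_id.aestronglyMeasurable 1 ?_
    filter_upwards [ae_mem_Icc m] with x hx
    rw [Real.norm_eq_abs, abs_of_nonneg hx.1]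
    exact hx.2
  constructor
  · exact integral_nonneg_of_ae ((ae_mem_Icc m).mono fun x hx => hx.1)
  · have := integral_mono_ae hint (integrable_const (1 : ℝ)) ((ae_mem_Icc m).mono fun x hx => hx.2)
    simpa [meanReward] using this

/-- The projection of the real line to `[0,1]`. -/
def clip (x : ℝ) : ℝ := max 0 (min 1 x)

theorem clip_mem_Icc (x : ℝ) : clip x ∈ Set.Icc (0 : ℝ) 1 := by
  simp [clip]

theorem measurable_clip : Measurable clip := by
  unfold clip; fun_prop

/-- Clipped observations are bounded for every history rather than almost every one, and their mean
is unchanged because the law is carried by `[0,1]`. -/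
theorem integral_clip (m : RewardLaw) : ∫ x, clip x ∂(m.1 : Measure ℝ) = meanReward m := by
  refine integral_congr_ae ((ae_mem_Icc m).mono fun x hx => ?_)
  simp [clip, hx.1, hx.2]

theorem isBoundedUnder_le (m : RewardLaw) :
    IsBoundedUnder (· ≤ ·) (ae (m.1 : Measure ℝ)) (fun x : ℝ => x) :=
  isBoundedUnder_of_eventually_le ((ae_mem_Icc m).mono fun _ hx => hx.2)

theorem isBoundedUnder_ge (m : RewardLaw) :
    IsBoundedUnder (· ≥ ·) (ae (m.1 : Measure ℝ)) (fun x : ℝ => x) :=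
  isBoundedUnder_of_eventually_ge ((ae_mem_Icc m).mono fun _ hx => hx.1)

theorem ae_le_rewardSup (m : RewardLaw) : ∀ᵐ x ∂(m.1 : Measure ℝ), x ≤ rewardSup m :=
  ae_le_essSup (hf := isBoundedUnder_le m)

theorem ae_rewardInf_le (m : RewardLaw) : ∀ᵐ x ∂(m.1 : Measure ℝ), rewardInf m ≤ x :=
  ae_essInf_le (hf := isBoundedUnder_ge m)

/-- Reduces measurability of `rewardSup` to that of the mass of half-lines. Essential boundedness
enters because a real `limsup` is only meaningful with it. -/
theorem rewardSup_le_iff (m : RewardLaw) (c : ℝ) :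
    rewardSup m ≤ c ↔ (m.1 : Measure ℝ) (Set.Ioi c) = 0 := by
  have h : (m.1 : Measure ℝ) (Set.Ioi c) = 0 ↔ ∀ᵐ x ∂(m.1 : Measure ℝ), x ≤ c := by
    rw [ae_iff]; simp only [not_le]; rfl
  rw [h]
  refine ⟨fun hc => (ae_le_rewardSup m).mono fun x hx => hx.trans hc, fun hc => ?_⟩
  exact limsup_le_of_le (isBoundedUnder_ge m).isCoboundedUnder_le hc

theorem le_rewardInf_iff (m : RewardLaw) (c : ℝ) :
    c ≤ rewardInf m ↔ (m.1 : Measure ℝ) (Set.Iio c) = 0 := by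
  have h : (m.1 : Measure ℝ) (Set.Iio c) = 0 ↔ ∀ᵐ x ∂(m.1 : Measure ℝ), c ≤ x := by
    rw [ae_iff]; simp only [not_le]; rfl
  rw [h]
  refine ⟨fun hc => (ae_rewardInf_le m).mono fun x hx => hc.trans hx, fun hc => ?_⟩
  exact le_liminf_of_le (isBoundedUnder_le m).isCoboundedUnder_ge hc

theorem measurable_rewardSup : Measurable rewardSup := by
  refine measurable_of_Iic fun c => ?_
  have : rewardSup ⁻¹' Set.Iic c = (fun m : RewardLaw => (m.1 : Measure ℝ) (Set.Ioi c)) ⁻¹' {0} := by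
    ext m; exact rewardSup_le_iff m c
  rw [this]
  exact ((Measure.measurable_coe measurableSet_Ioi).comp measurable_toMeasure)
    (measurableSet_singleton 0)

theorem measurable_rewardInf : Measurable rewardInf := by
  refine measurable_of_Ici fun c => ?_
  have : rewardInf ⁻¹' Set.Ici c = (fun m : RewardLaw => (m.1 : Measure ℝ) (Set.Iio c)) ⁻¹' {0} := by
    ext m; exact le_rewardInf_iff m c
  rw [this]
  exact ((Measure.measurable_coe measurableSet_Iio).comp measurable_toMeasure)
    (measurableSet_singleton 0)

/-- Absolutely continuous rewards are not constant. -/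
theorem rewardInf_lt_rewardSup (m : RewardLaw) : rewardInf m < rewardSup m := by
  by_contra! h
  have h1 : ∀ᵐ x ∂(m.1 : Measure ℝ), x ∈ ({rewardSup m} : Set ℝ) := by
    filter_upwards [ae_le_rewardSup m, ae_rewardInf_le m] with x hx hx'
    exact le_antisymm hx (h.trans hx')
  have h2 : (m.1 : Measure ℝ) {rewardSup m} = 0 := m.2 (by simp)
  have h3 : ∀ᵐ x ∂(m.1 : Measure ℝ), False := by
    filter_upwards [h1, measure_eq_zero_iff_ae_notMem.1 h2] with x hx hx' using hx' hx
  obtain ⟨x, hx⟩ := h3.exists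
  exact hx

theorem rewardSup_le_one (m : RewardLaw) : rewardSup m ≤ 1 := by
  rw [rewardSup_le_iff]
  exact measure_eq_zero_iff_ae_notMem.2 ((ae_mem_Icc m).mono fun x hx => not_lt.2 hx.2)

theorem rewardInf_nonneg (m : RewardLaw) : 0 ≤ rewardInf m := by
  rw [le_rewardInf_iff]
  exact measure_eq_zero_iff_ae_notMem.2 ((ae_mem_Icc m).mono fun x hx => not_lt.2 hx.1)

end RewardLaws

/-! ### Measurability and bounds of path probabilities and values. -/

section Measurability

variable {S : Type u} {A : Type v} [Fintype S] [Fintype A]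

theorem measurable_simplex_apply {α ι : Type*} [Fintype ι] [MeasurableSpace α]
    {f : α → stdSimplex ℝ ι} (hf : Measurable f) (i : ι) : Measurable (fun x => (f x).1 i) :=
  (measurable_pi_apply i).comp (measurable_subtype_coe.comp hf)

theorem measurable_pathProb {α : Type*} [MeasurableSpace α] (n : ℕ)
    {P : α → Fin n → Transition S A} {π : α → Policy S A n} (hP : ∀ i s a, Measurable (P · i s a))
    (hπ : ∀ i s, Measurable (π · i s)) (s : S) (τ : Fin n → S × A) :
    Measurable (fun x => pathProb n (P x) (π x) s τ) := by
  induction n generalizing s with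
  | zero => simp only [pathProb]; exact measurable_const
  | succ n ih =>
    simp only [pathProb]
    refine (measurable_const.mul (measurable_simplex_apply (hπ _ _) _)).mul
      (Finset.measurable_sum _ fun s' _ => (measurable_simplex_apply (hP _ _ _) _).mul ?_)
    exact ih (fun i s a => hP i.succ s a) (fun i s => hπ i.succ s) s' _

variable {H : ℕ}

theorem measurable_transition_apply (h : Fin H) (s : S) (a : A) :
    Measurable (fun E : Env S A H => E.1 h s a) :=
  (measurable_pi_apply a).comp ((measurable_pi_apply s).comp
    ((measurable_pi_apply h).comp measurable_fst))

theorem measurable_reward_apply (h : Fin H) (s : S) (a : A) :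
    Measurable (fun E : Env S A H => E.2 h s a) :=
  (measurable_pi_apply a).comp ((measurable_pi_apply s).comp
    ((measurable_pi_apply h).comp measurable_snd))

theorem measurable_policy_apply (h : Fin H) (s : S) :
    Measurable (fun π : Policy S A H => π h s) :=
  (measurable_pi_apply s).comp (measurable_pi_apply h)

theorem measurable_value (h : ℕ) (s : S) :
    Measurable (fun p : Env S A H × Policy S A H => value p.1 p.2 h s) := by
  unfold value
  refine Finset.measurable_sum _ fun τ _ => Measurable.mul ?_ ?_
  · exact measurable_pathProb _
      (fun i s a => (measurable_transition_apply _ s a).comp measurable_fst)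
      (fun i s => (measurable_policy_apply _ s).comp measurable_snd) _ _
  · exact Finset.measurable_sum _ fun i _ => measurable_meanReward.comp
      ((measurable_reward_apply _ _ _).comp measurable_fst)

theorem value_mem_Icc (E : Env S A H) (π : Policy S A H) (h : ℕ) (s : S) :
    value E π h s ∈ Set.Icc (0 : ℝ) H := by
  have := pathExp_sum_mem_Icc (dropLayers h E.1) (dropLayers h π) s
    (R := fun i s a => meanReward (dropLayers h E.2 i s a)) (fun i s a => meanReward_mem_Icc _)
  exact ⟨this.1, this.2.trans (by exact_mod_cast Nat.sub_le H h)⟩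

theorem dropLayers_zero {α : Type*} (x : Fin H → α) : dropLayers 0 x = x := by
  funext i
  simp [dropLayers]

theorem value_zero (E : Env S A H) (π : Policy S A H) (s : S) :
    value E π 0 s = pathExp H E.1 π s (fun τ => ∑ i, meanReward (E.2 i (τ i).1 (τ i).2)) := by
  have : value E π 0 s = pathExp (H - 0) (dropLayers 0 E.1) (dropLayers 0 π) s
    (fun τ => ∑ i, meanReward (dropLayers 0 E.2 i (τ i).1 (τ i).2)) := rfl
  rw [this, dropLayers_zero, dropLayers_zero, dropLayers_zero]
  rfl

end Measurability

/-! ### The law of an episode as a Markov kernel. -/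

section TrajLaw

variable {S : Type u} {A : Type v} [Fintype S] [Fintype A] [MeasurableSpace S] [MeasurableSpace A]
  {H : ℕ}

/-- The history with given states, actions and rewards. -/
def attachRewards (τ : Fin H → S × A) (x : Fin H → ℝ) : Traj S A H :=
  fun h => ((τ h).1, (τ h).2, x h)

theorem measurable_attachRewards (τ : Fin H → S × A) : Measurable (attachRewards τ) := by
  refine measurable_pi_lambda _ fun h => ?_
  exact measurable_const.prodMk (measurable_const.prodMk (measurable_pi_apply h))

theorem trajLaw_eq (E : Env S A H) (π : Policy S A H) (s₁ : S) :
    trajLaw E π s₁ = ∑ τ : Fin H → S × A, ENNReal.ofReal (pathProb H E.1 π s₁ τ) •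
      (Measure.pi (fun h : Fin H => ((E.2 h (τ h).1 (τ h).2).1 : Measure ℝ))).map
        (attachRewards τ) := rfl

instance isProbabilityMeasure_trajLaw (E : Env S A H) (π : Policy S A H) (s₁ : S) :
    IsProbabilityMeasure (trajLaw E π s₁) := by
  constructor
  have : ∀ τ : Fin H → S × A, IsProbabilityMeasure
      ((Measure.pi (fun h : Fin H => ((E.2 h (τ h).1 (τ h).2).1 : Measure ℝ))).map
        (attachRewards τ)) := fun τ =>
    Measure.isProbabilityMeasure_map (measurable_attachRewards τ).aemeasurable
  rw [trajLaw_eq]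
  simp only [Measure.coe_finsetSum, Finset.sum_apply, Measure.smul_apply, measure_univ,
    smul_eq_mul, mul_one]
  rw [← ENNReal.ofReal_sum_of_nonneg fun τ _ => pathProb_nonneg _ _ _ _ _, sum_pathProb]
  simp

theorem integral_trajLaw (E : Env S A H) (π : Policy S A H) (s₁ : S) {φ : Traj S A H → ℝ}
    (hφ : Measurable φ) {B : ℝ} (hB : ∀ t, |φ t| ≤ B) :
    ∫ t, φ t ∂(trajLaw E π s₁) = pathExp H E.1 π s₁ (fun τ => ∫ x, φ (attachRewards τ x)
      ∂(Measure.pi (fun h : Fin H => ((E.2 h (τ h).1 (τ h).2).1 : Measure ℝ)))) := by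
  have hprob : ∀ τ : Fin H → S × A, IsProbabilityMeasure
      ((Measure.pi (fun h : Fin H => ((E.2 h (τ h).1 (τ h).2).1 : Measure ℝ))).map
        (attachRewards τ)) := fun τ =>
    Measure.isProbabilityMeasure_map (measurable_attachRewards τ).aemeasurable
  rw [trajLaw_eq, integral_finsetSum_measure, pathExp]
  · refine Finset.sum_congr rfl fun τ _ => ?_
    rw [integral_smul_measure, ENNReal.toReal_ofReal (pathProb_nonneg _ _ _ _ _),
      integral_map (measurable_attachRewards τ).aemeasurable hφ.aestronglyMeasurable, smul_eq_mul]
  · intro τ _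
    exact (Integrable.of_bound hφ.aestronglyMeasurable B
      (ae_of_all _ hB)).smul_measure ENNReal.ofReal_ne_top

/-- It suffices to test on boxes, a generating π-system on which the product measure is a finite
product of measurable functions of the environment. -/
theorem measurable_pi_reward (τ : Fin H → S × A) : Measurable (fun E : Env S A H =>
    Measure.pi (fun h : Fin H => ((E.2 h (τ h).1 (τ h).2).1 : Measure ℝ))) := by
  refine Measurable.measure_of_isPiSystem_of_isProbabilityMeasure generateFrom_pi.symm
    isPiSystem_pi ?_
  rintro _ ⟨t, ht, rfl⟩
  simp only [Measure.pi_pi]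
  exact Finset.measurable_prod _ fun h _ =>
    (Measure.measurable_coe (show MeasurableSet (t h) from ht h (Set.mem_univ h))).comp
      (measurable_toMeasure.comp (measurable_reward_apply _ _ _))

theorem measurable_trajLaw (s₁ : S) :
    Measurable (fun p : Env S A H × Policy S A H => trajLaw p.1 p.2 s₁) := by
  refine Measure.measurable_of_measurable_coe _ fun B hB => ?_
  simp only [trajLaw_eq, Measure.coe_finsetSum, Finset.sum_apply, Measure.smul_apply, smul_eq_mul]
  refine Finset.measurable_sum _ fun τ _ => Measurable.mul ?_ ?_
  · exact (measurable_pathProb _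
      (fun i s a => (measurable_transition_apply _ s a).comp measurable_fst)
      (fun i s => (measurable_policy_apply _ s).comp measurable_snd) _ _).ennreal_ofReal
  · simp only [Measure.map_apply (measurable_attachRewards τ) hB]
    exact (Measure.measurable_coe (measurable_attachRewards τ hB)).comp
      ((measurable_pi_reward τ).comp measurable_fst)

/-- The law of the history of one episode as a kernel. -/
def trajKernel (s₁ : S) : Kernel (Env S A H × Policy S A H) (Traj S A H) :=
  ⟨fun p => trajLaw p.1 p.2 s₁, measurable_trajLaw s₁⟩

instance (s₁ : S) : IsMarkovKernel (trajKernel (A := A) (H := H) s₁) :=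
  ⟨fun p => isProbabilityMeasure_trajLaw p.1 p.2 s₁⟩

end TrajLaw

/-! ### Joint laws of data, environment, sample and episode. -/

section JointLaws

namespace TabularProblem.IsThompsonSampling

variable {S : Type u} {A : Type v} [Fintype S] [Fintype A] [MeasurableSpace S] [MeasurableSpace A]
  {H : ℕ} {M : TabularProblem S A H} {Ω : Type w} [MeasurableSpace Ω] {μ : Measure Ω}
  [IsProbabilityMeasure μ] {env : Ω → Env S A H} {sample : ℕ → Ω → Env S A H}
  {tr : ℕ → Ω → Traj S A H}

theorem measurable_history (hTS : M.IsThompsonSampling μ env sample tr) (l : ℕ) :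
    Measurable (history tr l) :=
  measurable_pi_lambda _ fun i => hTS.measurable_tr i

/-- Integrating `law_sample` over an event of the history gives both measures the same value on
rectangles, and these determine a finite measure. -/
theorem map_history_sample (hTS : M.IsThompsonSampling μ env sample tr) (l : ℕ) :
    μ.map (fun ω => (history tr l ω, sample l ω)) = μ.map (fun ω => (history tr l ω, env ω)) := by
  have hh := hTS.measurable_history l
  have hs := hTS.measurable_sample l
  have he := hTS.measurable_env
  have : IsProbabilityMeasure (μ.map (fun ω => (history tr l ω, sample l ω))) :=
    Measure.isProbabilityMeasure_map (hh.prodMk hs).aemeasurable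
  refine Measure.ext_prod fun {D B} hD hB => ?_
  rw [Measure.map_apply (hh.prodMk hs) (hD.prod hB), Measure.map_apply (hh.prodMk he) (hD.prod hB)]
  have hm1 : MeasurableSpace.comap env inferInstance ⊔
      MeasurableSpace.comap (history tr l) inferInstance ≤ (inferInstance : MeasurableSpace Ω) :=
    sup_le he.comap_le hh.comap_le
  have hm2 : MeasurableSpace.comap (history tr l) inferInstance ≤
    (inferInstance : MeasurableSpace Ω) := hh.comap_le
  have hD2 : MeasurableSet[MeasurableSpace.comap (history tr l) inferInstance]
    (history tr l ⁻¹' D) := ⟨D, hD, rfl⟩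
  have hD1 : MeasurableSet[MeasurableSpace.comap env inferInstance ⊔
      MeasurableSpace.comap (history tr l) inferInstance] (history tr l ⁻¹' D) :=
    (le_sup_right : MeasurableSpace.comap (history tr l) inferInstance ≤ _) _ hD2
  have h1 := setIntegral_condExp hm1
    (f := (sample l ⁻¹' B).indicator fun _ => (1 : ℝ)) (μ := μ)
    ((integrable_const (1 : ℝ)).indicator (hs hB)) hD1
  have h2 := setIntegral_condExp hm2
    (f := (env ⁻¹' B).indicator fun _ => (1 : ℝ)) (μ := μ)
    ((integrable_const (1 : ℝ)).indicator (he hB)) hD2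
  have h3 := integral_congr_ae (ae_restrict_of_ae (s := history tr l ⁻¹' D)
    (hTS.law_sample l B hB))
  rw [h3, h2] at h1
  have e1 : (fun ω => (history tr l ω, sample l ω)) ⁻¹' D ×ˢ B =
    sample l ⁻¹' B ∩ history tr l ⁻¹' D := by ext; simp [and_comm]
  have e2 : (fun ω => (history tr l ω, env ω)) ⁻¹' D ×ˢ B =
    env ⁻¹' B ∩ history tr l ⁻¹' D := by ext; simp [and_comm]
  rw [integral_indicator_const _ (he hB), integral_indicator_const _ (hs hB), smul_eq_mul,
    smul_eq_mul, mul_one, mul_one, measureReal_restrict_apply (he hB),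
    measureReal_restrict_apply (hs hB)] at h1
  rw [e1, e2, ← measureReal_eq_measureReal_iff]
  exact h1.symm

/-- Expectations of functions of the data and the sampled environment do not change when the
latter is replaced by the true environment. -/
theorem integral_history_sample (hTS : M.IsThompsonSampling μ env sample tr) (l : ℕ)
    {F : (Fin l → Traj S A H) × Env S A H → ℝ} (hF : Measurable F) :
    ∫ ω, F (history tr l ω, sample l ω) ∂μ = ∫ ω, F (history tr l ω, env ω) ∂μ := by
  rw [← integral_map (f := F) ((hTS.measurable_history l).prodMk
      (hTS.measurable_sample l)).aemeasurable hF.aestronglyMeasurable,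
    hTS.map_history_sample l, integral_map ((hTS.measurable_history l).prodMk
      hTS.measurable_env).aemeasurable hF.aestronglyMeasurable]

/-- The law of an episode, given the true environment, the data and the sampled environment. -/
theorem integral_episode (hTS : M.IsThompsonSampling μ env sample tr) (l : ℕ)
    {F : (Env S A H × (Fin l → Traj S A H) × Env S A H) × Traj S A H → ℝ} (hF : Measurable F)
    {B : ℝ} (hB : ∀ y, |F y| ≤ B) :
    ∫ ω, F ((env ω, history tr l ω, sample l ω), tr l ω) ∂μ =
      ∫ ω, ∫ t, F ((env ω, history tr l ω, sample l ω), t)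
        ∂(trajLaw (env ω) (M.optPolicy (sample l ω)) M.init) ∂μ := by
  have hh := hTS.measurable_history l
  have hs := hTS.measurable_sample l
  have he := hTS.measurable_env
  have ht := hTS.measurable_tr l
  set Y := fun ω => (env ω, history tr l ω, sample l ω) with hYdef
  have hY : Measurable Y := he.prodMk (hh.prodMk hs)
  have hg : Measurable (fun y : Env S A H × (Fin l → Traj S A H) × Env S A H =>
      (y.1, M.optPolicy y.2.2)) :=
    measurable_fst.prodMk (M.measurable_optPolicy.comp (measurable_snd.comp measurable_snd))
  set κ := (trajKernel M.init).comap _ hg with hκ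
  -- `law_tr` only speaks of one event `B` at a time. Integrated over events of `Y` it identifies
  -- the joint law on rectangles, which is enough.
  have hjoint : μ.map (fun ω => (Y ω, tr l ω)) = (μ.map Y) ⊗ₘ κ := by
    have : IsProbabilityMeasure (μ.map (fun ω => (Y ω, tr l ω))) :=
      Measure.isProbabilityMeasure_map (hY.prodMk ht).aemeasurable
    have : IsProbabilityMeasure (μ.map Y) := Measure.isProbabilityMeasure_map hY.aemeasurable
    refine Measure.ext_prod fun {D B} hD hB => ?_
    rw [Measure.map_apply (hY.prodMk ht) (hD.prod hB), Measure.compProd_apply_prod hD hB,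
      setLIntegral_map hD (κ.measurable_coe hB) hY]
    have hm : MeasurableSpace.comap env inferInstance ⊔
        MeasurableSpace.comap (history tr l) inferInstance ⊔
        MeasurableSpace.comap (sample l) inferInstance ≤ (inferInstance : MeasurableSpace Ω) :=
      sup_le (sup_le he.comap_le hh.comap_le) hs.comap_le
    have hD1 : MeasurableSet[MeasurableSpace.comap env inferInstance ⊔
        MeasurableSpace.comap (history tr l) inferInstance ⊔
        MeasurableSpace.comap (sample l) inferInstance] (Y ⁻¹' D) := by
      refine (Measurable.prodMk (Measurable.of_comap_le ?_) (Measurable.prodMk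
        (Measurable.of_comap_le ?_) (Measurable.of_comap_le ?_))) hD
      · exact le_sup_left.trans le_sup_left
      · exact le_sup_right.trans le_sup_left
      · exact le_sup_right
    have h1 := setIntegral_condExp hm
      (f := (tr l ⁻¹' B).indicator fun _ => (1 : ℝ)) (μ := μ)
      ((integrable_const (1 : ℝ)).indicator (ht hB)) hD1
    rw [integral_congr_ae (ae_restrict_of_ae (s := Y ⁻¹' D) (hTS.law_tr l B hB)),
      integral_indicator_const _ (ht hB), smul_eq_mul, mul_one,
      measureReal_restrict_apply (ht hB)] at h1
    have e1 : (fun ω => (Y ω, tr l ω)) ⁻¹' D ×ˢ B = tr l ⁻¹' B ∩ Y ⁻¹' D := by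
      ext; simp [and_comm]
    have e2 : ∀ ω, κ (Y ω) B = ENNReal.ofReal
        ((trajLaw (env ω) (M.optPolicy (sample l ω)) M.init).real B) := fun ω => by
      rw [ofReal_measureReal]; rfl
    have hint : Integrable (fun ω =>
        (trajLaw (env ω) (M.optPolicy (sample l ω)) M.init).real B) (μ.restrict (Y ⁻¹' D)) := by
      refine Integrable.of_bound (C := 1) ?_ (ae_of_all _ fun ω => ?_)
      · exact ((κ.measurable_coe hB).comp hY).ennreal_toReal.aestronglyMeasurable
      · rw [Real.norm_eq_abs, abs_of_nonneg measureReal_nonneg]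
        exact measureReal_le_one
    simp only [e2]
    rw [e1, ← ofReal_integral_eq_lintegral_ofReal hint (ae_of_all _ fun _ => measureReal_nonneg),
      h1, ofReal_measureReal]
  have hFi : Integrable F (μ.map Y ⊗ₘ κ) := by
    have : IsProbabilityMeasure (μ.map Y) := Measure.isProbabilityMeasure_map hY.aemeasurable
    exact Integrable.of_bound hF.aestronglyMeasurable B (ae_of_all _ hB)
  have h1 := integral_map (μ := μ) (f := F) (hY.prodMk ht).aemeasurable hF.aestronglyMeasurable
  rw [← h1, hjoint, Measure.integral_compProd hFi, integral_map hY.aemeasurable]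
  · rfl
  · exact (StronglyMeasurable.integral_kernel_prod_right' (κ := κ)
      hF.stronglyMeasurable).aestronglyMeasurable

end TabularProblem.IsThompsonSampling

end JointLaws

/-! ### Scalar parameters, their visits and unbiased observations. -/

section Features

variable {S : Type u} {A : Type v} [Fintype S] [Fintype A] {H : ℕ}

/-- The parameters of an environment that histories can reveal: for every layer and every
state-action pair the mean reward (`none`) and the probability of every next state. -/
abbrev Feature (S : Type u) (A : Type v) (H : ℕ) : Type (max u v) := Fin H × S × A × Option S

/-- The value of a parameter. -/
def featureMean (E : Env S A H) (j : Feature S A H) : ℝ :=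
  match j.2.2.2 with
  | none => meanReward (E.2 j.1 j.2.1 j.2.2.1)
  | some s' => (E.1 j.1 j.2.1 j.2.2.1).1 s'

open Classical in
/-- Indicator of the episodes that carry information on a parameter. -/
def featureVisit (t : Traj S A H) (j : Feature S A H) : ℝ :=
  if ((t j.1).1 = j.2.1 ∧ (t j.1).2.1 = j.2.2.1) ∧ (j.2.2.2 = none ∨ (j.1 : ℕ) + 1 < H) then 1
  else 0

open Classical in
/-- The observation, in such an episode, whose mean is the parameter. -/
def featureObs (t : Traj S A H) (j : Feature S A H) : ℝ :=
  match j.2.2.2 with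
  | none => clip (t j.1).2.2
  | some s' => if hh : (j.1 : ℕ) + 1 < H then (if (t ⟨j.1 + 1, hh⟩).1 = s' then 1 else 0) else 0

/-- The deviation of an observation from the parameter of the environment `E`, zero if there is no
visit. -/
def featureDev (t : Traj S A H) (E : Env S A H) (j : Feature S A H) : ℝ :=
  featureVisit t j * (featureObs t j - featureMean E j)

theorem featureMean_mem_Icc (E : Env S A H) (j : Feature S A H) :
    featureMean E j ∈ Set.Icc (0 : ℝ) 1 := by
  obtain ⟨h, s, a, o⟩ := j
  cases o with
  | none => exact meanReward_mem_Icc _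
  | some s' =>
    refine ⟨(E.1 h s a).2.1 s', ?_⟩
    rw [← (E.1 h s a).2.2]
    exact Finset.single_le_sum (f := (E.1 h s a).1) (fun i _ => (E.1 h s a).2.1 i)
      (Finset.mem_univ s')

theorem featureVisit_eq (t : Traj S A H) (j : Feature S A H) :
    featureVisit t j = 0 ∨ featureVisit t j = 1 := by
  unfold featureVisit; split_ifs <;> simp

theorem featureVisit_nonneg (t : Traj S A H) (j : Feature S A H) : 0 ≤ featureVisit t j := by
  rcases featureVisit_eq t j with h | h <;> simp [h]

theorem featureVisit_le_one (t : Traj S A H) (j : Feature S A H) : featureVisit t j ≤ 1 := by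
  rcases featureVisit_eq t j with h | h <;> simp [h]

theorem featureObs_mem_Icc (t : Traj S A H) (j : Feature S A H) :
    featureObs t j ∈ Set.Icc (0 : ℝ) 1 := by
  obtain ⟨h, s, a, o⟩ := j
  cases o with
  | none => exact clip_mem_Icc _
  | some s' => simp only [featureObs]; split_ifs <;> simp

theorem abs_featureMean_sub_le_one (E E' : Env S A H) (j : Feature S A H) :
    |featureMean E' j - featureMean E j| ≤ 1 := by
  have h1 := featureMean_mem_Icc E j
  have h2 := featureMean_mem_Icc E' j
  rw [abs_le]
  constructor <;> linarith [h1.1, h1.2, h2.1, h2.2]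

theorem abs_featureDev_le (t : Traj S A H) (E : Env S A H) (j : Feature S A H) :
    |featureDev t E j| ≤ featureVisit t j := by
  have h1 := featureMean_mem_Icc E j
  have h2 := featureObs_mem_Icc t j
  rw [featureDev, abs_mul, abs_of_nonneg (featureVisit_nonneg t j)]
  refine mul_le_of_le_one_right (featureVisit_nonneg t j) ?_
  rw [abs_le]
  constructor <;> linarith [h1.1, h1.2, h2.1, h2.2]

/-- The model discrepancies along an episode are controlled by those of the visited parameters. -/
theorem sum_modelGap_le (hH : 0 < H) (E E' : Env S A H) (t : Traj S A H) :
    ∑ i, modelGap (H : ℝ) E.1 E'.1 (fun i s a => meanReward (E.2 i s a))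
        (fun i s a => meanReward (E'.2 i s a)) i (t i).1 (t i).2.1 ≤
      H * ∑ j : Feature S A H, featureVisit t j * |featureMean E' j - featureMean E j| := by
  have hH1 : (1 : ℝ) ≤ H := by exact_mod_cast hH
  set g : Feature S A H → ℝ := fun j =>
    featureVisit t j * |featureMean E' j - featureMean E j| with hg
  have hg0 : ∀ j, 0 ≤ g j := fun j => mul_nonneg (featureVisit_nonneg t j) (abs_nonneg _)
  rw [Finset.mul_sum, Fintype.sum_prod_type]
  refine Finset.sum_le_sum fun i _ => ?_
  rw [← Finset.mul_sum, Fintype.sum_prod_type]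
  have h1 : ∑ y : A × Option S, g (i, (t i).1, y) ≤ ∑ s, ∑ y : A × Option S, g (i, s, y) :=
    Finset.single_le_sum (f := fun s => ∑ y : A × Option S, g (i, s, y))
      (fun s _ => Finset.sum_nonneg fun y _ => hg0 _) (Finset.mem_univ _)
  have h2 : ∑ o : Option S, g (i, (t i).1, (t i).2.1, o) ≤
      ∑ y : A × Option S, g (i, (t i).1, y) := by
    rw [Fintype.sum_prod_type]
    exact Finset.single_le_sum (f := fun a => ∑ o : Option S, g (i, (t i).1, a, o))
      (fun a _ => Finset.sum_nonneg fun o _ => hg0 _) (Finset.mem_univ _)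
  refine le_trans ?_ (mul_le_mul_of_nonneg_left (h2.trans h1) (by positivity))
  rw [Fintype.sum_option, mul_add, modelGap]
  refine add_le_add ?_ ?_
  · have : g (i, (t i).1, (t i).2.1, none) =
        |meanReward (E'.2 i (t i).1 (t i).2.1) - meanReward (E.2 i (t i).1 (t i).2.1)| := by
      simp [hg, featureVisit, featureMean]
    rw [this]
    exact le_mul_of_one_le_left (abs_nonneg _) hH1
  · refine mul_le_mul_of_nonneg_left ?_ (by positivity)
    split_ifs with hi
    · refine Finset.sum_le_sum fun s' _ => le_of_eq ?_
      simp [hg, featureVisit, featureMean, hi]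
    · exact Finset.sum_nonneg fun s' _ => hg0 _

theorem measurable_featureMean (j : Feature S A H) :
    Measurable (fun E : Env S A H => featureMean E j) := by
  obtain ⟨h, s, a, o⟩ := j
  cases o with
  | none => exact measurable_meanReward.comp (measurable_reward_apply h s a)
  | some s' => exact measurable_simplex_apply (measurable_transition_apply h s a) s'

variable [MeasurableSpace S] [DiscreteMeasurableSpace S] [MeasurableSpace A]
  [DiscreteMeasurableSpace A]

theorem measurableSet_state_eq (h : Fin H) (s : S) :
    MeasurableSet {t : Traj S A H | (t h).1 = s} :=
  (measurable_fst.comp (measurable_pi_apply h)) (MeasurableSet.of_discrete (s := {s}))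

theorem measurableSet_action_eq (h : Fin H) (a : A) :
    MeasurableSet {t : Traj S A H | (t h).2.1 = a} :=
  (measurable_fst.comp (measurable_snd.comp (measurable_pi_apply h)))
    (MeasurableSet.of_discrete (s := {a}))

theorem measurable_featureVisit (j : Feature S A H) :
    Measurable (fun t : Traj S A H => featureVisit t j) :=
  Measurable.ite (((measurableSet_state_eq _ _).inter (measurableSet_action_eq _ _)).inter
    (MeasurableSet.const _)) measurable_const measurable_const

theorem measurable_featureObs (j : Feature S A H) :
    Measurable (fun t : Traj S A H => featureObs t j) := by
  obtain ⟨h, s, a, o⟩ := j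
  cases o with
  | none =>
    exact measurable_clip.comp (measurable_snd.comp (measurable_snd.comp (measurable_pi_apply h)))
  | some s' =>
    simp only [featureObs]
    split_ifs
    · exact Measurable.ite (measurableSet_state_eq _ _) measurable_const measurable_const
    · exact measurable_const

theorem measurable_featureDev (j : Feature S A H) :
    Measurable (fun p : Traj S A H × Env S A H => featureDev p.1 p.2 j) :=
  ((measurable_featureVisit j).comp measurable_fst).mul
    (((measurable_featureObs j).comp measurable_fst).sub
      ((measurable_featureMean j).comp measurable_snd))

/-- The observations are unbiased. -/
theorem integral_featureDev (E : Env S A H) (π : Policy S A H) (s₁ : S) (j : Feature S A H) :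
    ∫ t, featureDev t E j ∂(trajLaw E π s₁) = 0 := by
  classical
  rw [integral_trajLaw E π s₁ (φ := fun t => featureDev t E j)
    ((measurable_featureDev j).comp (measurable_id.prodMk measurable_const))
    (B := 1) fun t => (abs_featureDev_le t E j).trans (featureVisit_le_one t j)]
  obtain ⟨h, s, a, o⟩ := j
  cases o with
  | none =>
    -- For a reward parameter the mean already vanishes for each fixed state-action path, after
    -- averaging over the rewards.
    refine Eq.trans ?_ (pathExp_const H E.1 π s₁ 0)
    congr 1
    funext τ
    by_cases hτ : (τ h).1 = s ∧ (τ h).2 = a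
    · have e : ∀ x, featureDev (attachRewards τ x) E (h, s, a, none) =
          clip (x h) - meanReward (E.2 h (τ h).1 (τ h).2) := fun x => by
        simp [featureDev, featureVisit, featureObs, featureMean, attachRewards, hτ.1, hτ.2]
      simp only [e]
      rw [integral_sub _ (integrable_const _)]
      · have := integral_map (μ := Measure.pi
            (fun h : Fin H => ((E.2 h (τ h).1 (τ h).2).1 : Measure ℝ)))
          (measurable_pi_apply h).aemeasurable (f := clip) measurable_clip.aestronglyMeasurable
        rw [← this, (measurePreserving_eval _ h).map_eq, integral_clip]
        simp
      · refine Integrable.of_bound (C := 1)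
          (measurable_clip.comp (measurable_pi_apply h)).aestronglyMeasurable
          (ae_of_all _ fun x => ?_)
        rw [Real.norm_eq_abs, abs_of_nonneg (clip_mem_Icc _).1]
        exact (clip_mem_Icc _).2
    · have e : ∀ x, featureDev (attachRewards τ x) E (h, s, a, none) = 0 := fun x => by
        simp [featureDev, featureVisit, attachRewards, hτ]
      simp [e]
  | some s' =>
    by_cases hh : (h : ℕ) + 1 < H
    · refine Eq.trans ?_ (pathExp_transition H E.1 π s₁ h hh s a s')
      congr 1
      funext τ
      have e : ∀ x, featureDev (attachRewards τ x) E (h, s, a, some s') =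
          if τ h = (s, a) then (if (τ ⟨h + 1, hh⟩).1 = s' then 1 else 0) - (E.1 h s a).1 s'
          else 0 := fun x => by
        simp [featureDev, featureVisit, featureObs, featureMean, attachRewards, hh, Prod.ext_iff]
        congr
      simp [e]
    · refine Eq.trans ?_ (pathExp_const H E.1 π s₁ 0)
      congr 1
      funext τ
      have e : ∀ x, featureDev (attachRewards τ x) E (h, s, a, some s') = 0 := fun x => by
        simp [featureDev, featureVisit, hh]
      simp [e]

end Features

/-! ### Speed of learning of a single parameter. -/

section Estimation

variable {S : Type u} {A : Type v} [Fintype S] [Fintype A] [MeasurableSpace S] [MeasurableSpace A]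
  {H : ℕ}

/-- The number of past visits. -/
def visitCount {l : ℕ} (D : Fin l → Traj S A H) (j : Feature S A H) : ℝ :=
  ∑ i, featureVisit (D i) j

/-- The sum of the past deviations from the parameter of `E`. -/
def totalDev {l : ℕ} (D : Fin l → Traj S A H) (E : Env S A H) (j : Feature S A H) : ℝ :=
  ∑ i, featureDev (D i) E j

theorem visitCount_nonneg {l : ℕ} (D : Fin l → Traj S A H) (j : Feature S A H) :
    0 ≤ visitCount D j :=
  Finset.sum_nonneg fun _ _ => featureVisit_nonneg _ _

theorem abs_totalDev_le {l : ℕ} (D : Fin l → Traj S A H) (E : Env S A H) (j : Feature S A H) :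
    |totalDev D E j| ≤ l := by
  refine (Finset.abs_sum_le_sum_abs _ _).trans ((Finset.sum_le_sum fun i _ =>
    (abs_featureDev_le (D i) E j).trans (featureVisit_le_one _ j)).trans ?_)
  simp

/-- Both deviations are built from the same observations, which cancel in the difference, so the two
environments are compared without an intermediate estimator. The extra `1` pays for replacing `n` by
`n + 1`, since parameters differ by at most `1`. -/
theorem visitCount_mul_abs_sub_le {l : ℕ} (D : Fin l → Traj S A H) (E E' : Env S A H)
    (j : Feature S A H) :
    (visitCount D j + 1) * |featureMean E' j - featureMean E j| ≤
      |totalDev D E' j| + |totalDev D E j| + 1 := by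
  have h : visitCount D j * (featureMean E' j - featureMean E j) =
      totalDev D E j - totalDev D E' j := by
    simp only [visitCount, totalDev, featureDev, Finset.sum_mul, ← Finset.sum_sub_distrib]
    exact Finset.sum_congr rfl fun _ _ => by ring
  have h1 : visitCount D j * |featureMean E' j - featureMean E j| ≤
      |totalDev D E' j| + |totalDev D E j| := by
    rw [← abs_of_nonneg (visitCount_nonneg D j), ← abs_mul, h, add_comm]
    exact abs_sub _ _
  linarith [abs_featureMean_sub_le_one E E' j]

variable [DiscreteMeasurableSpace S] [DiscreteMeasurableSpace A]

theorem measurable_visitCount (l : ℕ) (j : Feature S A H) :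
    Measurable (fun D : Fin l → Traj S A H => visitCount D j) :=
  Finset.measurable_sum _ fun i _ => (measurable_featureVisit j).comp (measurable_pi_apply i)

theorem measurable_totalDev (l : ℕ) (j : Feature S A H) :
    Measurable (fun p : (Fin l → Traj S A H) × Env S A H => totalDev p.1 p.2 j) :=
  Finset.measurable_sum _ fun i _ => (measurable_featureDev j).comp
    (f := fun p : (Fin l → Traj S A H) × Env S A H => (p.1 i, p.2))
    (((measurable_pi_apply i).comp measurable_fst).prodMk measurable_snd)

namespace TabularProblem.IsThompsonSampling

variable {M : TabularProblem S A H} {Ω : Type w} [MeasurableSpace Ω] {μ : Measure Ω}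
  [IsProbabilityMeasure μ] {env : Ω → Env S A H} {sample : ℕ → Ω → Env S A H}
  {tr : ℕ → Ω → Traj S A H}

theorem visitCount_history (l : ℕ) (ω : Ω) (j : Feature S A H) :
    visitCount (history tr l ω) j = ∑ i ∈ Finset.range l, featureVisit (tr i ω) j :=
  Fin.sum_univ_eq_sum_range (fun i => featureVisit (tr i ω) j) l

theorem totalDev_history (l : ℕ) (ω : Ω) (E : Env S A H) (j : Feature S A H) :
    totalDev (history tr l ω) E j = ∑ i ∈ Finset.range l, featureDev (tr i ω) E j :=
  Fin.sum_univ_eq_sum_range (fun i => featureDev (tr i ω) E j) l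

/-- The slope depends only on the true environment and the past, and observations are unbiased under
every policy, in particular under the one selected by the sample. This gives the orthogonality
required by `integral_pow_four_div_le`. -/
theorem integral_totalDev_env_le (hTS : M.IsThompsonSampling μ env sample tr) (l : ℕ)
    (j : Feature S A H) :
    ∫ ω, totalDev (history tr l ω) (env ω) j ^ 4 / (visitCount (history tr l ω) j + 1) ^ 2 ∂μ ≤
      11 * Real.log (l + 1) := by
  simp only [visitCount_history, totalDev_history]
  refine integral_pow_four_div_le (fun i ω => featureDev (tr i ω) (env ω) j)
    (fun i ω => featureVisit (tr i ω) j)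
    (fun i => (measurable_featureDev j).comp ((hTS.measurable_tr i).prodMk hTS.measurable_env))
    (fun i => (measurable_featureVisit j).comp (hTS.measurable_tr i))
    (fun i ω => featureVisit_eq _ _) (fun i ω => abs_featureDev_le _ _ _) (fun n => ?_) l
  have hF : Measurable (fun y : (Env S A H × (Fin n → Traj S A H) × Env S A H) × Traj S A H =>
      devSlope (totalDev y.1.2.1 y.1.1 j) (visitCount y.1.2.1 j) * featureDev y.2 y.1.1 j) := by
    have hE : Measurable (fun y : (Env S A H × (Fin n → Traj S A H) × Env S A H) × Traj S A H =>
      y.1.1) := measurable_fst.comp measurable_fst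
    have hD : Measurable (fun y : (Env S A H × (Fin n → Traj S A H) × Env S A H) × Traj S A H =>
      y.1.2.1) := measurable_fst.comp (measurable_snd.comp measurable_fst)
    exact (measurable_devSlope.comp (((measurable_totalDev n j).comp (hD.prodMk hE)).prodMk
      ((measurable_visitCount n j).comp hD))).mul
      ((measurable_featureDev j).comp (measurable_snd.prodMk hE))
  have h := hTS.integral_episode n hF (B := 4 * (n : ℝ) ^ 3 + 16 * n) fun y => by
    rw [abs_mul]
    refine (mul_le_of_le_one_right (abs_nonneg _)
      ((abs_featureDev_le _ _ j).trans (featureVisit_le_one _ j))).trans ?_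
    exact abs_devSlope_le (abs_totalDev_le _ _ _) (visitCount_nonneg _ _)
  simp only [integral_const_mul, integral_featureDev, mul_zero, integral_zero] at h
  simpa only [visitCount_history, totalDev_history] using h

/-- Thompson sampling learns every parameter fast enough, on the episodes that carry information
on it. -/
theorem sum_integral_feature_le (hTS : M.IsThompsonSampling μ env sample tr) (j : Feature S A H)
    {c : ℝ} (hc : 0 < c) (L : ℕ) :
    ∑ l ∈ Finset.range L, ∫ ω, featureVisit (tr l ω) j *
      |featureMean (sample l ω) j - featureMean (env ω) j| ∂μ ≤ featureBound c L := by
  set W : ℕ → Ω → ℝ := fun l ω => featureVisit (tr l ω) j *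
    (((visitCount (history tr l ω) j + 1) ^ (1 / 3 : ℝ)) ^ 2)⁻¹ with hW
  have hvm : ∀ l, Measurable (fun ω => featureVisit (tr l ω) j) := fun l =>
    (measurable_featureVisit j).comp (hTS.measurable_tr l)
  have hnm : ∀ l, Measurable (fun ω => visitCount (history tr l ω) j) := fun l =>
    (measurable_visitCount l j).comp (hTS.measurable_history l)
  have hWm : ∀ l, Measurable (W l) := fun l =>
    (hvm l).mul ((((hnm l).add_const 1).pow_const _).pow_const 2).inv
  have hW1 : ∀ l ω, |W l ω| ≤ 1 := fun l ω => by
    have h1 : 1 ≤ (visitCount (history tr l ω) j + 1) ^ (1 / 3 : ℝ) :=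
      Real.one_le_rpow (by linarith [visitCount_nonneg (history tr l ω) j]) (by norm_num)
    have h2 : (((visitCount (history tr l ω) j + 1) ^ (1 / 3 : ℝ)) ^ 2)⁻¹ ≤ 1 :=
      inv_le_one_of_one_le₀ (one_le_pow₀ h1)
    have h3 : 0 ≤ (((visitCount (history tr l ω) j + 1) ^ (1 / 3 : ℝ)) ^ 2)⁻¹ := by positivity
    rw [hW, abs_of_nonneg (mul_nonneg (featureVisit_nonneg _ _) h3)]
    exact mul_le_one₀ (featureVisit_le_one _ _) h3 h2
  have hWi : ∀ l, Integrable (W l) μ := fun l =>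
    Integrable.of_bound (hWm l).aestronglyMeasurable 1 (ae_of_all _ (hW1 l))
  set G : (l : ℕ) → (Fin l → Traj S A H) × Env S A H → ℝ := fun l p =>
    totalDev p.1 p.2 j ^ 4 / (visitCount p.1 j + 1) ^ 2 with hG
  have hGm : ∀ l, Measurable (G l) := fun l =>
    ((measurable_totalDev l j).pow_const 4).div
      ((((measurable_visitCount l j).comp measurable_fst).add_const 1).pow_const 2)
  have hG1 : ∀ l p, |G l p| ≤ (l : ℝ) ^ 4 := fun l p => by
    have hn := visitCount_nonneg p.1 j
    rw [hG, abs_div, abs_pow, abs_of_nonneg (show 0 ≤ (visitCount p.1 j + 1) ^ 2 by positivity)]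
    refine (div_le_self (by positivity) (one_le_pow₀ (by linarith))).trans ?_
    exact pow_le_pow_left₀ (abs_nonneg _) (abs_totalDev_le _ _ _) 4
  have hGs : ∀ l, Integrable (fun ω => G l (history tr l ω, sample l ω)) μ := fun l =>
    Integrable.of_bound ((hGm l).comp ((hTS.measurable_history l).prodMk
      (hTS.measurable_sample l))).aestronglyMeasurable _ (ae_of_all _ fun ω => hG1 l _)
  have hGe : ∀ l, Integrable (fun ω => G l (history tr l ω, env ω)) μ := fun l =>
    Integrable.of_bound ((hGm l).comp ((hTS.measurable_history l).prodMk
      hTS.measurable_env)).aestronglyMeasurable _ (ae_of_all _ fun ω => hG1 l _)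
  have hGse : ∀ l, Integrable (fun ω => (G l (history tr l ω, sample l ω) +
      G l (history tr l ω, env ω)) / c ^ 3) μ := fun l => ((hGs l).add (hGe l)).div_const _
  have hstep : ∀ l ∈ Finset.range L, ∫ ω, featureVisit (tr l ω) j *
      |featureMean (sample l ω) j - featureMean (env ω) j| ∂μ ≤
      (2 * c + 1) * ∫ ω, W l ω ∂μ + 2 * (11 * Real.log (L + 1)) / c ^ 3 := by
    intro l hl
    have hl' : (l : ℝ) ≤ L := by exact_mod_cast (Finset.mem_range.1 hl).le
    have h1 : ∫ ω, featureVisit (tr l ω) j *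
        |featureMean (sample l ω) j - featureMean (env ω) j| ∂μ ≤
        ∫ ω, ((2 * c + 1) * W l ω + (G l (history tr l ω, sample l ω) +
          G l (history tr l ω, env ω)) / c ^ 3) ∂μ := by
      refine integral_mono_of_nonneg
        (ae_of_all _ fun ω => mul_nonneg (featureVisit_nonneg _ _) (abs_nonneg _))
        (((hWi l).const_mul _).add (hGse l)) (ae_of_all _ fun ω => ?_)
      have := visit_mul_abs_le (visitCount_nonneg (history tr l ω) j)
        (featureVisit_eq (tr l ω) j) hc (abs_nonneg _) (abs_nonneg _)
        (visitCount_mul_abs_sub_le (history tr l ω) (env ω) (sample l ω) j)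
      rwa [Even.pow_abs (by decide), Even.pow_abs (by decide)] at this
    -- Here the deviation from the sampled parameter is exchanged for that from the true one, as `G`
    -- depends only on the data and one environment.
    rw [integral_add ((hWi l).const_mul _) (hGse l), integral_const_mul,
      integral_div, integral_add (hGs l) (hGe l), hTS.integral_history_sample l (hGm l)] at h1
    refine h1.trans (add_le_add le_rfl (div_le_div_of_nonneg_right ?_ (by positivity)))
    have h2 := (hTS.integral_totalDev_env_le l j).trans (mul_le_mul_of_nonneg_left
      (Real.log_le_log (by positivity) (add_le_add hl' le_rfl)) (by norm_num : (0 : ℝ) ≤ 11))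
    linarith
  refine (Finset.sum_le_sum hstep).trans ?_
  rw [Finset.sum_add_distrib, Finset.sum_const, Finset.card_range, nsmul_eq_mul, featureBound,
    ← Finset.mul_sum, ← integral_finsetSum _ fun l _ => hWi l]
  refine add_le_add (mul_le_mul_of_nonneg_left ?_ (by positivity)) le_rfl
  -- The weights telescope along each history, and there are at most `L` visits.
  have hpath : ∀ ω, ∑ l ∈ Finset.range L, W l ω ≤ 3 * (L : ℝ) ^ (1 / 3 : ℝ) := by
    intro ω
    have h1 : ∀ n : ℕ, ∑ l ∈ Finset.range n, W l ω ≤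
        3 * visitCount (history tr n ω) j ^ (1 / 3 : ℝ) := by
      intro n
      induction n with
      | zero => simp [visitCount]
      | succ n ih =>
        have h2 := visitWeight_step (visitCount_nonneg (history tr n ω) j)
          (featureVisit_eq (tr n ω) j)
        have h3 : visitCount (history tr (n + 1) ω) j =
            visitCount (history tr n ω) j + featureVisit (tr n ω) j := by
          rw [visitCount_history, visitCount_history, Finset.sum_range_succ]
        rw [Finset.sum_range_succ, h3]
        linarith
    refine (h1 L).trans (mul_le_mul_of_nonneg_left (Real.rpow_le_rpow (visitCount_nonneg _ _) ?_
      (by norm_num)) (by norm_num))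
    refine (Finset.sum_le_sum fun i _ => featureVisit_le_one _ j).trans ?_
    simp
  refine (integral_mono (integrable_finsetSum _ fun l _ => hWi l) (integrable_const _)
    hpath).trans ?_
  simp

end TabularProblem.IsThompsonSampling

end Estimation

namespace TabularProblem

/-! ### Positivity of the value diameter. -/

section Diameter

variable {S : Type u} {A : Type v} [Fintype S] [Fintype A] {H : ℕ}

theorem measurable_optValue (M : TabularProblem S A H) (h : ℕ) (s : S) :
    Measurable (fun E => M.optValue E h s) :=
  (measurable_value h s).comp (measurable_id.prodMk M.measurable_optPolicy)

theorem measurable_envDiameter (M : TabularProblem S A H) : Measurable M.envDiameter := by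
  unfold envDiameter
  refine Measurable.add ?_ ?_
  · exact Measurable.iSup fun h => (Measurable.iSup fun s => M.measurable_optValue h s).sub
      (Measurable.iInf fun s => M.measurable_optValue h s)
  · exact Measurable.iSup fun p => (measurable_rewardSup.comp (measurable_reward_apply _ _ _)).sub
      (measurable_rewardInf.comp (measurable_reward_apply _ _ _))

theorem isProbabilityMeasure_prior (M : TabularProblem S A H) : IsProbabilityMeasure M.prior := by
  have := M.isProb_priorP
  have := M.isProb_priorR
  unfold prior
  infer_instance

/-- The prior has mass one, so some environment and hence some policy exists; a probability vector
cannot live on an empty set. -/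
theorem nonempty_action (M : TabularProblem S A H) (hH : 0 < H) : Nonempty A := by
  have := M.isProbabilityMeasure_prior
  obtain ⟨E⟩ : Nonempty (Env S A H) := nonempty_of_isProbabilityMeasure M.prior
  by_contra h
  rw [not_nonempty_iff] at h
  have := (M.optPolicy E ⟨0, hH⟩ M.init).2.2
  simp at this

theorem optValue_oscillation_mem_Icc (M : TabularProblem S A H) (E : Env S A H) (h : ℕ) :
    (⨆ s : S, M.optValue E h s) - ⨅ s : S, M.optValue E h s ∈ Set.Icc (0 : ℝ) H := by
  have : Nonempty S := ⟨M.init⟩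
  have hV := fun s => value_mem_Icc E (M.optPolicy E) h s
  have h1 : ⨆ s : S, M.optValue E h s ≤ H := ciSup_le fun s => (hV s).2
  have h2 : 0 ≤ ⨅ s : S, M.optValue E h s := le_ciInf fun s => (hV s).1
  have h3 := le_ciSup (f := fun s => M.optValue E h s) (Set.finite_range _).bddAbove M.init
  have h4 := ciInf_le (f := fun s => M.optValue E h s) (Set.finite_range _).bddBelow M.init
  exact ⟨by linarith, by linarith⟩

theorem envDiameter_pos (M : TabularProblem S A H) (hH : 0 < H) (E : Env S A H) :
    0 < M.envDiameter E := by
  obtain ⟨a⟩ := M.nonempty_action hH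
  refine add_pos_of_nonneg_of_pos
    (Real.iSup_nonneg fun h => (M.optValue_oscillation_mem_Icc E h).1) ?_
  refine lt_of_lt_of_le (sub_pos.2 (rewardInf_lt_rewardSup (E.2 ⟨0, hH⟩ M.init a))) ?_
  exact le_ciSup (f := fun p : Fin H × S × A =>
    rewardSup (E.2 p.1 p.2.1 p.2.2) - rewardInf (E.2 p.1 p.2.1 p.2.2))
    (Set.finite_range _).bddAbove (⟨0, hH⟩, M.init, a)

theorem envDiameter_le (M : TabularProblem S A H) (E : Env S A H) : M.envDiameter E ≤ H + 1 := by
  refine add_le_add (Real.iSup_le (fun h => (M.optValue_oscillation_mem_Icc E h).2)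
    (by positivity)) (Real.iSup_le (fun p => ?_) zero_le_one)
  linarith [rewardSup_le_one (E.2 p.1 p.2.1 p.2.2), rewardInf_nonneg (E.2 p.1 p.2.1 p.2.2)]

/-- Since rewards are absolutely continuous, the value diameter does not vanish. -/
theorem valueDiameter_pos (M : TabularProblem S A H) (hH : 0 < H) : 0 < M.valueDiameter := by
  have := M.isProbabilityMeasure_prior
  refine Real.sqrt_pos.2 ?_
  -- Integrability is essential: otherwise the integral defining the diameter would take the default
  -- value zero.
  have hint : Integrable (fun E => M.envDiameter E ^ 2) M.prior := by
    refine Integrable.of_bound (M.measurable_envDiameter.pow_const 2).aestronglyMeasurable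
      (((H : ℝ) + 1) ^ 2) (ae_of_all _ fun E => ?_)
    rw [Real.norm_eq_abs, abs_of_nonneg (sq_nonneg _)]
    exact pow_le_pow_left₀ (M.envDiameter_pos hH E).le (M.envDiameter_le E) 2
  rw [integral_pos_iff_support_of_nonneg (fun E => sq_nonneg _) hint]
  have : Function.support (fun E => M.envDiameter E ^ 2) = Set.univ := by
    ext E
    simp [(M.envDiameter_pos hH E).ne']
  rw [this, measure_univ]
  exact zero_lt_one

end Diameter

/-! ### From regret to parameter errors. -/

section Regret

variable {S : Type u} {A : Type v} [Fintype S] [Fintype A] [MeasurableSpace S]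
  [DiscreteMeasurableSpace S] [MeasurableSpace A] [DiscreteMeasurableSpace A]
  {H : ℕ} {M : TabularProblem S A H} {Ω : Type w} [MeasurableSpace Ω] {μ : Measure Ω}
  [IsProbabilityMeasure μ] {env : Ω → Env S A H} {sample : ℕ → Ω → Env S A H}
  {tr : ℕ → Ω → Traj S A H}

namespace IsThompsonSampling

/-- The regret of one episode in terms of the errors of the visited parameters. -/
theorem integral_regret_le (hTS : M.IsThompsonSampling μ env sample tr) (hH : 0 < H) (l : ℕ) :
    ∫ ω, (M.optValue (env ω) 0 M.init - value (env ω) (M.optPolicy (sample l ω)) 0 M.init) ∂μ ≤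
      H * ∑ j : Feature S A H, ∫ ω, featureVisit (tr l ω) j *
        |featureMean (sample l ω) j - featureMean (env ω) j| ∂μ := by
  have hs := hTS.measurable_sample l
  have he := hTS.measurable_env
  set Φ : (Env S A H × (Fin l → Traj S A H) × Env S A H) × Traj S A H → ℝ := fun y =>
    H * ∑ j : Feature S A H, featureVisit y.2 j *
      |featureMean y.1.2.2 j - featureMean y.1.1 j| with hΦ
  have hΦm : Measurable Φ := by
    have hE : Measurable (fun y : (Env S A H × (Fin l → Traj S A H) × Env S A H) × Traj S A H =>
      y.1.1) := measurable_fst.comp measurable_fst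
    have hE' : Measurable (fun y : (Env S A H × (Fin l → Traj S A H) × Env S A H) × Traj S A H =>
      y.1.2.2) := measurable_snd.comp (measurable_snd.comp measurable_fst)
    refine (Finset.measurable_sum _ fun j _ => ?_).const_mul _
    exact ((measurable_featureVisit j).comp measurable_snd).mul
      (((measurable_featureMean j).comp hE').sub ((measurable_featureMean j).comp hE)).abs
  have hterm : ∀ (t : Traj S A H) (E E' : Env S A H) (j : Feature S A H),
      0 ≤ featureVisit t j * |featureMean E' j - featureMean E j| ∧
      featureVisit t j * |featureMean E' j - featureMean E j| ≤ 1 := fun t E E' j =>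
    ⟨mul_nonneg (featureVisit_nonneg _ _) (abs_nonneg _),
      mul_le_one₀ (featureVisit_le_one _ _) (abs_nonneg _) (abs_featureMean_sub_le_one _ _ _)⟩
  have hΦb : ∀ y, |Φ y| ≤ H * Fintype.card (Feature S A H) := fun y => by
    rw [abs_of_nonneg (mul_nonneg (by positivity)
      (Finset.sum_nonneg fun j _ => (hterm _ _ _ j).1))]
    refine mul_le_mul_of_nonneg_left ?_ (by positivity)
    refine (Finset.sum_le_sum fun j _ => (hterm _ _ _ j).2).trans ?_
    simp
  have hVi : ∀ f : Ω → Env S A H × Policy S A H, Measurable f →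
      Integrable (fun ω => value (f ω).1 (f ω).2 0 M.init) μ := fun f hf => by
    refine Integrable.of_bound (C := H)
      ((measurable_value 0 M.init).comp hf).aestronglyMeasurable (ae_of_all _ fun ω => ?_)
    have := value_mem_Icc (f ω).1 (f ω).2 0 M.init
    rw [Real.norm_eq_abs, abs_of_nonneg this.1]
    exact this.2
  have hi1 : Integrable (fun ω => M.optValue (env ω) 0 M.init) μ :=
    hVi (fun ω => (env ω, M.optPolicy (env ω))) (he.prodMk (M.measurable_optPolicy.comp he))
  have hi2 : Integrable (fun ω => value (env ω) (M.optPolicy (sample l ω)) 0 M.init) μ :=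
    hVi (fun ω => (env ω, M.optPolicy (sample l ω)))
      (he.prodMk (M.measurable_optPolicy.comp hs))
  have hi3 : Integrable (fun ω => M.optValue (sample l ω) 0 M.init) μ :=
    hVi (fun ω => (sample l ω, M.optPolicy (sample l ω)))
      (hs.prodMk (M.measurable_optPolicy.comp hs))
  -- The optimal value is a function of the environment alone, so its expectation is the same for
  -- the sample. Afterwards only the sampled policy appears, evaluated in two models.
  have hswap := hTS.integral_history_sample l
    (F := fun p => M.optValue p.2 0 M.init) ((M.measurable_optValue 0 M.init).comp measurable_snd)
  have hepisode := hTS.integral_episode l hΦm hΦb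
  rw [integral_sub hi1 hi2, ← hswap, ← integral_sub hi3 hi2]
  have hsum : ∫ ω, Φ ((env ω, history tr l ω, sample l ω), tr l ω) ∂μ =
      H * ∑ j : Feature S A H, ∫ ω, featureVisit (tr l ω) j *
        |featureMean (sample l ω) j - featureMean (env ω) j| ∂μ := by
    simp only [hΦ]
    rw [integral_const_mul, integral_finsetSum]
    intro j _
    refine Integrable.of_bound (C := 1) (((measurable_featureVisit j).comp
      (hTS.measurable_tr l)).mul (((measurable_featureMean j).comp hs).sub
        ((measurable_featureMean j).comp he)).abs).aestronglyMeasurable (ae_of_all _ fun ω => ?_)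
    rw [Real.norm_eq_abs, abs_of_nonneg (hterm _ _ _ j).1]
    exact (hterm _ _ _ j).2
  rw [← hsum, hepisode]
  have hY : Measurable (fun ω => (env ω, history tr l ω, sample l ω)) :=
    he.prodMk ((hTS.measurable_history l).prodMk hs)
  have hinner : Integrable (fun ω => ∫ t, Φ ((env ω, history tr l ω, sample l ω), t)
      ∂(trajLaw (env ω) (M.optPolicy (sample l ω)) M.init)) μ := by
    have hg : Measurable (fun y : Env S A H × (Fin l → Traj S A H) × Env S A H =>
        (y.1, M.optPolicy y.2.2)) :=
      measurable_fst.prodMk (M.measurable_optPolicy.comp (measurable_snd.comp measurable_snd))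
    refine Integrable.of_bound (C := H * Fintype.card (Feature S A H))
      ((StronglyMeasurable.integral_kernel_prod_right' (κ := (trajKernel M.init).comap _ hg)
        hΦm.stronglyMeasurable).measurable.comp hY).aestronglyMeasurable (ae_of_all _ fun ω => ?_)
    refine (norm_integral_le_of_norm_le_const (ae_of_all _ fun t => hΦb _)).trans ?_
    simp
  refine integral_mono (hi3.sub hi2) hinner fun ω => ?_
  have hsim := abs_pathExp_sub_le H (env ω).1 (sample l ω).1
    (fun i s a => meanReward ((env ω).2 i s a)) (fun i s a => meanReward ((sample l ω).2 i s a))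
    (fun i s a => meanReward_mem_Icc _) H le_rfl (M.optPolicy (sample l ω)) M.init
  rw [← value_zero, ← value_zero] at hsim
  refine (le_abs_self _).trans (hsim.trans ?_)
  have hsection : Measurable (fun t => Φ ((env ω, history tr l ω, sample l ω), t)) :=
    hΦm.comp measurable_prodMk_left
  rw [integral_trajLaw _ _ _ hsection fun t => hΦb _]
  refine pathExp_mono _ _ _ fun τ => ?_
  -- The left side involves only states and actions, so the bound holds for all rewards `x` and
  -- survives averaging over them.
  have hx : ∀ x, ∑ i, modelGap (H : ℝ) (env ω).1 (sample l ω).1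
      (fun i s a => meanReward ((env ω).2 i s a)) (fun i s a => meanReward ((sample l ω).2 i s a))
      i (τ i).1 (τ i).2 ≤ Φ ((env ω, history tr l ω, sample l ω), attachRewards τ x) := fun x =>
    sum_modelGap_le hH (env ω) (sample l ω) (attachRewards τ x)
  have := integral_mono (μ := Measure.pi
      (fun h : Fin H => (((env ω).2 h (τ h).1 (τ h).2).1 : Measure ℝ))) (integrable_const _)
    (Integrable.of_bound (hsection.comp (measurable_attachRewards τ)).aestronglyMeasurable _
      (ae_of_all _ fun x => hΦb _)) hx
  simpa using this

theorem bayesRegret_le (hTS : M.IsThompsonSampling μ env sample tr) (hH : 0 < H) {c : ℝ}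
    (hc : 0 < c) (L : ℕ) :
    M.bayesRegret μ env sample L ≤
      H * Fintype.card (Feature S A H) * featureBound c L := by
  refine (Finset.sum_le_sum fun l _ => hTS.integral_regret_le hH l).trans ?_
  rw [← Finset.mul_sum, Finset.sum_comm, mul_assoc]
  refine mul_le_mul_of_nonneg_left ?_ (by positivity)
  refine (Finset.sum_le_sum fun j _ => hTS.sum_integral_feature_le j hc L).trans ?_
  simp

end IsThompsonSampling

end Regret

end TabularProblem

end BayesRL

end

/-! ### The regret bound. -/

theorem corollary1 :
    ∃ C : ℝ, 0 < C ∧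
      ∀ (S : Type*) (A : Type*) [Fintype S] [Fintype A]
        [MeasurableSpace S] [DiscreteMeasurableSpace S]
        [MeasurableSpace A] [DiscreteMeasurableSpace A]
        (H : ℕ) (_ : 0 < H) (M : BayesRL.TabularProblem S A H)
        (Ω : Type*) [MeasurableSpace Ω] (μ : MeasureTheory.Measure Ω)
        [MeasureTheory.IsProbabilityMeasure μ]
        (env : Ω → BayesRL.Env S A H) (sample : ℕ → Ω → BayesRL.Env S A H)
        (tr : ℕ → Ω → BayesRL.Traj S A H),
        M.IsThompsonSampling μ env sample tr →
        M.HasConsistentEstimator μ env tr →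
        M.VisitsEverything →
        ∃ L₀ : ℕ, ∀ L : ℕ, L₀ ≤ L → ∀ T : ℝ, T = (L : ℝ) * H →
          M.bayesRegret μ env sample L ≤
            C * M.valueDiameter *
              Real.sqrt (H * Fintype.card S * Fintype.card A * T) *
              Real.sqrt (Real.log (H * Fintype.card S * Fintype.card A * L)) := by
  -- Any positive constant would do, as the regret is of smaller order than the bound.
  refine ⟨1, one_pos, ?_⟩
  intro S A _ _ _ _ _ _ H hH M Ω _ μ _ env sample tr hTS _ _
  obtain ⟨L₀, hL₀⟩ := Filter.eventually_atTop.1 (BayesRL.eventually_featureBound_le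
    (H * Fintype.card (BayesRL.Feature S A H)) M.valueDiameter (by positivity)
    (M.valueDiameter_pos hH))
  -- `L ≥ 1` makes the logarithm monotone from `L` to `HSAL`. Since `T ≥ L` and `HSA ≥ 1`, the
  -- claimed bound dominates `λ √L √(log L)`.
  refine ⟨max L₀ 1, fun L hL T hT => ?_⟩
  obtain ⟨c, hc, hbound⟩ := hL₀ L ((le_max_left _ _).trans hL)
  refine (hTS.bayesRegret_le hH hc L).trans (hbound.trans ?_)
  have : Nonempty S := ⟨M.init⟩
  have := M.nonempty_action hH
  have hL1 : (1 : ℝ) ≤ L := by exact_mod_cast (le_max_right _ _).trans hL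
  have hH1 : (1 : ℝ) ≤ H := by exact_mod_cast hH
  have hS1 : (1 : ℝ) ≤ Fintype.card S := by exact_mod_cast Fintype.card_pos
  have hA1 : (1 : ℝ) ≤ Fintype.card A := by exact_mod_cast Fintype.card_pos
  have hHSA : (1 : ℝ) ≤ H * Fintype.card S * Fintype.card A :=
    one_le_mul_of_one_le_of_one_le (one_le_mul_of_one_le_of_one_le hH1 hS1) hA1
  have hT' : (L : ℝ) ≤ T := hT ▸ le_mul_of_one_le_right (by positivity) hH1
  have hlam := (M.valueDiameter_pos hH).le
  rw [one_mul]
  refine mul_le_mul (mul_le_mul_of_nonneg_left (Real.sqrt_le_sqrt ?_) hlam)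
    (Real.sqrt_le_sqrt (Real.log_le_log (by positivity) ?_)) (Real.sqrt_nonneg _) (by positivity)
  · exact hT'.trans (le_mul_of_one_le_left (by linarith) hHSA)
  · exact le_mul_of_one_le_left (by linarith) hHSA
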